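/- **Growth order groups.** An ordered group is a group $\mathcal G$ with a linear order such that $g>h$ implies $fg>fh$ and $gf>hf$. Write $\mathcal C(g)$ for the centraliser of $g$, $\mathcal G^{>}=\{g:g>1\}$ and $\mathcal G^{\neq}=\mathcal G\setminus\{1\}$. Write $f\preccurlyeq g$ if $f=1$, or if $g\neq1$ and $g_0\leqslant f\leqslant g_1$ for some $g_0,g_1\in\mathcal C(g)$; $f\asymp g$ if $f\preccurlyeq g$ and $g\preccurlyeq f$; $f\prec g$ if $f\preccurlyeq g$ and not $g\asymp f$; and $g\sim h$ if $gh^{-1}\prec g$ (for $g,h\in\mathcal G^{\neq}$). An element $s\in\mathcal G^{>}$ is *scaling* if $\mathcal C(s)$ is Abelian and for each $f\asymp s$ there is $g\in\mathcal C(s)$, $g\neq 1$, with $g\sim f$. An ordered group $\mathcal G$ is a *growth order group* if 1. for all $f,g\in\mathcal G^{>}$ with $f\geqslant g$ and all $g_0\in\mathcal C(g)$ there is $f_0\in\mathcal C(f)$ with $f_0\geqslant g_0$; 2. for all $f,g\in\mathcal G^{>}$, if $f>c$ for every $c\in\mathcal C(g)$, then $fg>gf$; 3. for each $g\in\mathcal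 G^{\neq}$ there is a scaling $s$ with $s\asymp g$. It has *Archimedean centralisers* if for each $g\in\mathcal G^{\neq}$ and all $f,h\in\mathcal C(g)\setminus\{1\}$ there is $n\in\mathbb Z$ with $f^n\geqslant h$. **Hardy fields.** Let $\mathcal C^{<\infty}$ be the ring of germs at $+\infty$ of real-valued functions which, for each $k\in\mathbb N$, are $k$ times differentiable on some half-line $(a_k,+\infty)$, with $f<g$ meaning that $f(t)<g(t)$ for all large $t$. A *Hardy field* is a subfield $\mathcal H$ of $\mathcal C^{<\infty}$ that is closed under derivation and contains all constant germs; it is viewed as an ordered valued differential field with valuation ring the set of $f\in\mathcal H$ with $|f|<r$ for some $r\in\mathbb R$. Let $\mathcal H^{>\mathbb R}$ be the set of $f\in\mathcal H$ with $f>r$ for all $r\in\mathbb R$. The Hardy field $\mathcal H$ is *with composition and inversion* if $f\circ g\in\mathcal H$ for all $f\in\mathcal H$, $g\in\mathcal H^{>\mathbb R}$, and each $f\in\mathcal H^{>\mathbb R}$ has a compositional inverse in $\mathcal H^{>\mathbb R}$. **Exponential H-fields.** An *H-field* is an ordered field $K$ with a convex valuation ring $\mathcal O$, with maximal ideal $\mathcal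 o$, and a derivation $\partial$, with $C=\operatorname{Ker}\partial$, such that each $a\in\mathcal O$ has some $c\in C$ with $a-c\in\mathcal o$, and $\partial(a)>0$ for each $a\in K$ with $a>C$. An *exponential H-field* is an H-field $K$ with $C=\mathbb R$, together with an isomorphism of ordered groups $\log:(K^{>},\cdot,1,<)\to(K,+,0,<)$, where $K^{>}=\{a\in K:a>0\}$, such that $\log(1+\mathcal o)=\mathcal o$ and $\partial(a)/a=\partial(\log a)$ for all $a\in K^{>}$. Put $K^{>\mathbb R}=\{a\in K:a>r\text{ for all }r\in\mathbb R\}$, and let $\log^{[k]}$ be the $k$-fold iterate of $\log$, which maps $K^{>\mathbb R}$ to itself. **Proposition.** Let $\mathcal H$ be a Hardy field with composition and inversion containing the germ of $\exp$, let $K$ be an exponential H-field and let $\Phi:\mathcal H\to K$ be an embedding of ordered valued differential fields. Set $x:=\Phi(\mathrm{id})$, and suppose that for all $a\in K^{>\mathbb R}$ there is $l\in\mathbb Z$ such that for all sufficiently large $k\in\mathbb N$, $$\log^{[k]}(a)-\log^{[k-l]}(x)\in\mathcal o .$$ Then $\mathcal H^{>\mathbb R}$, with composition of germs, neutral element $\mathrm{id}$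 and the ordering $<$ above, is a growth order group with Archimedean centralisers. -/

import Mathlib

noncomputable section

namespace GrowthOrder

open Filter Set

/-! ### Ordered groups and growth order groups -/

section Groups

/-- A group with a linear order is an ordered group if both translations are strictly increasing. -/
def IsOrderedGroup (G : Type*) [Group G] [LinearOrder G] : Prop :=
  ∀ f g h : G, h < g → f * h < f * g ∧ h * f < g * f

/-- The centraliser `𝒞(g)` of an element. -/
abbrev centraliser {G : Type*} [Group G] (g : G) : Subgroup G :=
  Subgroup.centralizer {g}

/-- Archimedean: for all `f, g ≠ 1` there is `n ∈ ℤ` with `f ^ n ≥ g`. -/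
def IsArchimedean (G : Type*) [Group G] [LinearOrder G] : Prop :=
  ∀ f g : G, f ≠ 1 → g ≠ 1 → ∃ n : ℤ, g ≤ f ^ n

/-- Every centraliser of a non-trivial element is an Archimedean ordered group. -/
def HasArchimedeanCentralisers (G : Type*) [Group G] [LinearOrder G] : Prop :=
  ∀ g : G, g ≠ 1 → IsArchimedean (centraliser g)

/-- First growth axiom. -/
def GOG1 (G : Type*) [Group G] [LinearOrder G] : Prop :=
  ∀ f g : G, 1 < f → 1 < g → g ≤ f →
    ∀ g₀ ∈ centraliser g, ∃ f₀ ∈ centraliser f, g₀ ≤ f₀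

/-- Second growth axiom: for `f, g > 1`, if `f > 𝒞(g)` then `f g > g f`. -/
def GOG2 (G : Type*) [Group G] [LinearOrder G] : Prop :=
  ∀ f g : G, 1 < f → 1 < g → (∀ c ∈ centraliser g, c < f) → g * f < f * g

/-- `f ≼ g`: either `f = 1`, or `g ≠ 1` and `f` lies in the convex hull of `𝒞(g)`. -/
def Preceq {G : Type*} [Group G] [LinearOrder G] (f g : G) : Prop :=
  f = 1 ∨ (g ≠ 1 ∧ ∃ g₀ ∈ centraliser g, ∃ g₁ ∈ centraliser g, g₀ ≤ f ∧ f ≤ g₁)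

/-- `f ≍ g`: `f` and `g` have the same growth rank. -/
def Asymp {G : Type*} [Group G] [LinearOrder G] (f g : G) : Prop :=
  Preceq f g ∧ Preceq g f

/-- `f ≺ g`: `f ≼ g` and not `g ≍ f`. -/
def Prec {G : Type*} [Group G] [LinearOrder G] (f g : G) : Prop :=
  Preceq f g ∧ ¬ Asymp g f

/-- `g ∼ h`: `g h⁻¹ ≺ g` (used for non-trivial `g`, `h`). -/
def Sim {G : Type*} [Group G] [LinearOrder G] (g h : G) : Prop :=
  Prec (g * h⁻¹) g

/-- `s > 1` is scaling if `𝒞(s)` is Abelian and every `f ≍ s` satisfies `g ∼ f` for some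
non-trivial `g ∈ 𝒞(s)`. -/
def IsScaling {G : Type*} [Group G] [LinearOrder G] (s : G) : Prop :=
  1 < s ∧ (∀ a ∈ centraliser s, ∀ b ∈ centraliser s, a * b = b * a) ∧
    ∀ f : G, Asymp f s → ∃ g ∈ centraliser s, g ≠ 1 ∧ Sim g f

/-- Third growth axiom: each growth rank (class of a non-trivial `g` for `≍`) contains a scaling
element. -/
def GOG3 (G : Type*) [Group G] [LinearOrder G] : Prop :=
  ∀ g : G, g ≠ 1 → ∃ s : G, Asymp s g ∧ IsScaling s

/-- Growth order groups. -/
structure IsGrowthOrderGroup (G : Type*) [Group G] [LinearOrder G] : Prop where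
  ordered : IsOrderedGroup G
  gog1 : GOG1 G
  gog2 : GOG2 G
  gog3 : GOG3 G

end Groups

/-! ### Germs at `+∞` of real functions -/

section Germs

/-- Germs at `+∞` of real-valued functions. -/
abbrev RGerm : Type := Germ (atTop : Filter ℝ) ℝ

/-- The germ of the identity. -/
def idGerm : RGerm := ((fun t : ℝ => t : ℝ → ℝ) : RGerm)

/-- The germ of the exponential function. -/
def expGerm : RGerm := ((fun t : ℝ => Real.exp t : ℝ → ℝ) : RGerm)

/-- The germ of a constant function. -/
def constGerm (r : ℝ) : RGerm := ((fun _ : ℝ => r : ℝ → ℝ) : RGerm)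

/-- Eventual strict comparison: `f t < g t` for all sufficiently large `t`. -/
def EvLT (f g : RGerm) : Prop := Germ.LiftRel (· < ·) f g

/-- `f > ℝ`: the germ lies above all constant germs. -/
def AboveReals (f : RGerm) : Prop := ∀ r : ℝ, EvLT (constGerm r) f

/-- The germ lies in `𝒞^{<∞}`: for each `k`, some representative (equivalently, each one) is `k`
times continuously differentiable on a half-line depending on `k`.  As this is for all `k`,
continuity of the `k`-th derivative is no restriction. -/
def IsSmoothGerm (f : RGerm) : Prop :=
  ∃ u : ℝ → ℝ, (u : RGerm) = f ∧ ∀ k : ℕ, ∃ a : ℝ, ContDiffOn ℝ k u (Ioi a)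

theorem deriv_eventuallyEq {u v : ℝ → ℝ} (h : u =ᶠ[atTop] v) : deriv u =ᶠ[atTop] deriv v := by
  obtain ⟨a, ha⟩ := eventually_atTop.1 h
  filter_upwards [eventually_gt_atTop a] with t ht
  refine EventuallyEq.deriv_eq ?_
  filter_upwards [Ioi_mem_nhds ht] with s hs using ha s (le_of_lt hs)

/-- Derivative of a germ: `[u]' = [u']`. -/
def derivGerm : RGerm → RGerm :=
  Germ.map' (fun u : ℝ → ℝ => deriv u) (fun _ _ h => deriv_eventuallyEq h)

theorem AboveReals.tendsto {g : RGerm} (hg : AboveReals g) : g.Tendsto atTop := by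
  induction g using Germ.inductionOn with
  | _ v =>
    exact tendsto_atTop.2 fun r => (Germ.liftRel_coe.1 (hg r)).mono fun _ h => le_of_lt h

/-- Composition `[u] ∘ [v] = [u ∘ v]` of germs, for `[v] > ℝ`. -/
def compGerm (f g : RGerm) (hg : AboveReals g) : RGerm := f.compTendsto' g hg.tendsto

theorem compGerm_coe (u v : ℝ → ℝ) (hv : AboveReals (v : RGerm)) :
    compGerm (u : RGerm) (v : RGerm) hv = ((u ∘ v : ℝ → ℝ) : RGerm) := rfl

theorem aboveReals_coe {v : ℝ → ℝ} : AboveReals (v : RGerm) ↔ Tendsto v atTop atTop :=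
  ⟨fun h => h.tendsto, fun h r => Germ.liftRel_coe.2 (h.eventually_gt_atTop r)⟩

theorem AboveReals.comp {f g : RGerm} (hf : AboveReals f) (hg : AboveReals g) :
    AboveReals (compGerm f g hg) := by
  induction f using Germ.inductionOn with
  | _ u =>
  induction g using Germ.inductionOn with
  | _ v =>
    rw [compGerm_coe, aboveReals_coe]
    exact (aboveReals_coe.1 hf).comp (aboveReals_coe.1 hg)

theorem compGerm_assoc (f g h : RGerm) (hg : AboveReals g) (hh : AboveReals h) :
    compGerm (compGerm f g hg) h hh = compGerm f (compGerm g h hh) (hg.comp hh) := by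
  induction f using Germ.inductionOn with
  | _ u =>
  induction g using Germ.inductionOn with
  | _ v =>
  induction h using Germ.inductionOn with
  | _ w => rfl

theorem aboveReals_id : AboveReals idGerm := aboveReals_coe.2 tendsto_id

theorem aboveReals_exp : AboveReals expGerm := aboveReals_coe.2 Real.tendsto_exp_atTop

theorem comp_idGerm (f : RGerm) : compGerm f idGerm aboveReals_id = f := by
  induction f using Germ.inductionOn with
  | _ u => rfl

theorem idGerm_comp (f : RGerm) (hf : AboveReals f) : compGerm idGerm f hf = f := by
  induction f using Germ.inductionOn with
  | _ u => rfl

end Germs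

/-! ### Hardy fields -/

section Hardy

/-- A Hardy field: a differential subfield of `𝒞^{<∞}` containing all constant germs. -/
structure HardyField extends Subring RGerm where
  smooth : ∀ f ∈ carrier, IsSmoothGerm f
  const_mem : ∀ r : ℝ, constGerm r ∈ carrier
  deriv_mem : ∀ f ∈ carrier, derivGerm f ∈ carrier
  exists_inv : ∀ f ∈ carrier, f ≠ 0 → ∃ g ∈ carrier, f * g = 1

/-- A Hardy field with composition and inversion: it is closed under composition of germs, and its
set of germs above `ℝ` is closed under functional inversion. -/
structure HardyFieldCompInv extends HardyField where
  comp_mem : ∀ f ∈ carrier, ∀ g ∈ carrier, ∀ hg : AboveReals g, compGerm f g hg ∈ carrier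
  exists_compInv : ∀ f ∈ carrier, ∀ hf : AboveReals f,
    ∃ g ∈ carrier, ∃ hg : AboveReals g, compGerm f g hg = idGerm ∧ compGerm g f hf = idGerm

/-- A Hardy field with composition and inversion that contains the germ of `exp`. -/
structure ExpHardyField extends HardyFieldCompInv where
  exp_mem : expGerm ∈ carrier

/-- The identity germ, being `exp ∘ log`, lies in such a field. -/
theorem ExpHardyField.id_mem (H : ExpHardyField) : idGerm ∈ H.carrier := by
  obtain ⟨g, hgH, hg, h, -⟩ := H.exists_compInv _ H.exp_mem aboveReals_exp
  exact h ▸ H.comp_mem _ H.exp_mem g hgH hg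

/-- The set `ℋ^{>ℝ}` of germs in `ℋ` above all constants. -/
def ExpHardyField.Large (H : ExpHardyField) : Type :=
  {f : RGerm // f ∈ H.carrier ∧ AboveReals f}

/-- The group `ℋ^{>ℝ}` under composition, with neutral element the identity germ. -/
instance (H : ExpHardyField) : Group H.Large where
  mul f g := ⟨compGerm f.1 g.1 g.2.2, H.comp_mem _ f.2.1 _ g.2.1 g.2.2, f.2.2.comp g.2.2⟩
  one := ⟨idGerm, H.id_mem, aboveReals_id⟩
  inv f := ⟨(H.exists_compInv f.1 f.2.1 f.2.2).choose,
    (H.exists_compInv f.1 f.2.1 f.2.2).choose_spec.1,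
    (H.exists_compInv f.1 f.2.1 f.2.2).choose_spec.2.choose⟩
  mul_assoc f g h := Subtype.ext (compGerm_assoc f.1 g.1 h.1 g.2.2 h.2.2)
  one_mul f := Subtype.ext (idGerm_comp f.1 f.2.2)
  mul_one f := Subtype.ext (comp_idGerm f.1)
  inv_mul_cancel f := Subtype.ext
    (H.exists_compInv f.1 f.2.1 f.2.2).choose_spec.2.choose_spec.2

/-- Germs of a Hardy field are linearly ordered by eventual comparison. -/
theorem HardyField.evLT_trichotomy (H : HardyField) {f g : RGerm} (hf : f ∈ H.carrier)
    (hg : g ∈ H.carrier) : EvLT f g ∨ f = g ∨ EvLT g f := by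
  by_cases hfg : f = g
  · exact Or.inr (Or.inl hfg)
  have hd : g - f ∈ H.carrier := H.toSubring.sub_mem hg hf
  obtain ⟨w, -, hw⟩ := H.exists_inv _ hd (sub_ne_zero.2 (Ne.symm hfg))
  obtain ⟨d, hd', hsm⟩ := H.smooth _ hd
  obtain ⟨a, ha⟩ := hsm 0
  have hc : ContinuousOn d (Ioi a) := ha.continuousOn
  rw [← hd'] at hw
  have hne : ∀ᶠ t in atTop, d t ≠ 0 := by
    induction w using Germ.inductionOn with
    | _ w =>
      have h1 : (fun t => d t * w t) =ᶠ[atTop] fun _ => (1 : ℝ) := Germ.coe_eq.1 hw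
      filter_upwards [h1] with t ht h0
      simp [h0] at ht
  obtain ⟨b, hb⟩ := eventually_atTop.1 (hne.and (eventually_gt_atTop a))
  have hcb : ContinuousOn d (Ici b) := hc.mono fun t ht => (hb t ht).2
  have hsign : (∀ t ∈ Ici b, 0 < d t) ∨ (∀ t ∈ Ici b, d t < 0) := by
    by_contra hcon
    push Not at hcon
    obtain ⟨⟨s, hs, hs0⟩, t, ht, ht0⟩ := hcon
    obtain ⟨r, hr, hr0⟩ := isPreconnected_Ici.intermediate_value hs ht hcb ⟨hs0, ht0⟩
    exact (hb r hr).1 hr0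
  induction f using Germ.inductionOn with
  | _ u =>
  induction g using Germ.inductionOn with
  | _ v =>
    have he : d =ᶠ[atTop] fun t => v t - u t := Germ.coe_eq.1 hd'
    rcases hsign with h | h
    · refine Or.inl (Germ.liftRel_coe.2 ?_)
      filter_upwards [he, eventually_ge_atTop b] with t ht htb
      have := h t htb
      linarith
    · refine Or.inr (Or.inr (Germ.liftRel_coe.2 ?_))
      filter_upwards [he, eventually_ge_atTop b] with t ht htb
      have := h t htb
      linarith

theorem EvLT.trans {f g h : RGerm} (h₁ : EvLT f g) (h₂ : EvLT g h) : EvLT f h := by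
  induction f using Germ.inductionOn with
  | _ u =>
  induction g using Germ.inductionOn with
  | _ v =>
  induction h using Germ.inductionOn with
  | _ w =>
    refine Germ.liftRel_coe.2 ?_
    filter_upwards [Germ.liftRel_coe.1 h₁, Germ.liftRel_coe.1 h₂] with t a b using lt_trans a b

theorem EvLT.irrefl (f : RGerm) : ¬ EvLT f f := by
  induction f using Germ.inductionOn with
  | _ u =>
    intro h
    obtain ⟨t, ht⟩ := (Germ.liftRel_coe.1 h).exists
    exact lt_irrefl _ ht

open Classical in
/-- The linear order on `ℋ^{>ℝ}`: `f < g` is eventual strict comparison. -/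
instance (H : ExpHardyField) : LinearOrder H.Large where
  le f g := f = g ∨ EvLT f.1 g.1
  lt f g := EvLT f.1 g.1
  le_refl f := Or.inl rfl
  le_trans f g h h₁ h₂ := by
    rcases h₁ with rfl | h₁
    · exact h₂
    · rcases h₂ with rfl | h₂
      · exact Or.inr h₁
      · exact Or.inr (h₁.trans h₂)
  lt_iff_le_not_ge f g := by
    constructor
    · intro h
      refine ⟨Or.inr h, ?_⟩
      rintro (rfl | h')
      · exact EvLT.irrefl _ h
      · exact EvLT.irrefl _ (h.trans h')
    · rintro ⟨rfl | h, h'⟩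
      · exact absurd (Or.inl rfl) h'
      · exact h
  le_antisymm f g h₁ h₂ := by
    rcases h₁ with rfl | h₁
    · rfl
    · rcases h₂ with h₂ | h₂
      · exact h₂.symm
      · exact absurd (h₁.trans h₂) (EvLT.irrefl _)
  le_total f g := by
    rcases H.evLT_trichotomy f.2.1 g.2.1 with h | h | h
    · exact Or.inl (Or.inr h)
    · exact Or.inl (Or.inl (Subtype.ext h))
    · exact Or.inr (Or.inr h)
  toDecidableLE := Classical.decRel _

end Hardy

/-! ### H-fields and exponential H-fields -/

section HFields

/-- An H-field structure on an ordered field `K`: a convex valuation ring `𝒪` and a derivation `∂`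
such that, with `C = Ker ∂` and `𝓸` the maximal ideal of `𝒪`, one has `𝒪 ⊆ C + 𝓸`, and `∂ a > 0`
for all `a > C`. -/
structure HField (K : Type*) [Field K] [LinearOrder K] [IsStrictOrderedRing K] where
  /-- The valuation ring `𝒪`. -/
  valRing : ValuationSubring K
  /-- The derivation `∂`. -/
  der : Derivation ℤ K K
  convex : (valRing : Set K).OrdConnected
  exists_const : ∀ a ∈ valRing, ∃ c : K, der c = 0 ∧ a - c ∈ valRing.nonunits
  der_pos : ∀ a : K, (∀ c : K, der c = 0 → c < a) → 0 < der a

/-- An exponential H-field: an H-field whose field of constants is `ℝ`, with an isomorphism of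
ordered groups `log` from `(K^{>}, ·, 1, <)` onto `(K, +, 0, <)` such that `log (1 + 𝓸) = 𝓸` and
`∂ a / a = ∂ (log a)` for all `a > 0`. -/
structure ExponentialHField (K : Type*) [Field K] [LinearOrder K] [IsStrictOrderedRing K]
    [Algebra ℝ K] extends HField K where
  der_eq_zero_iff : ∀ a : K, der a = 0 ↔ ∃ r : ℝ, algebraMap ℝ K r = a
  /-- The logarithm. -/
  log : {a : K // 0 < a} ≃o K
  log_mul : ∀ a b : {a : K // 0 < a}, log (a * b) = log a + log b
  log_image : log '' {a | (a : K) - 1 ∈ valRing.nonunits} = (valRing.nonunits : Set K)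
  der_log : ∀ a : {a : K // 0 < a}, der (a : K) / (a : K) = der (log a)

variable {K : Type*} [Field K] [LinearOrder K] [IsStrictOrderedRing K] [Algebra ℝ K]

open Classical in
/-- The logarithm as a function on `K`, with the value `0` outside `K^{>}`. -/
def ExponentialHField.logFun (E : ExponentialHField K) (a : K) : K :=
  if h : 0 < a then E.log ⟨a, h⟩ else 0

/-- The `k`-fold iterate `log^{[k]}(a)`; for `a > ℝ` all iterates are `> ℝ`, so that the value of
`logFun` outside `K^{>}` plays no role. -/
def ExponentialHField.logIter (E : ExponentialHField K) (k : ℕ) (a : K) : K :=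
  E.logFun^[k] a

/-- `Φ : ℋ → K` is an embedding of ordered valued differential fields, where `ℋ` carries eventual
comparison, the derivation of germs, and the valuation ring of its germs bounded by reals. -/
structure IsHardyEmbedding (H : HardyField) (E : ExponentialHField K)
    (Φ : H.toSubring →+* K) : Prop where
  lt_iff : ∀ f g : H.toSubring, Φ f < Φ g ↔ EvLT (f : RGerm) (g : RGerm)
  mem_valRing_iff : ∀ f : H.toSubring,
    Φ f ∈ E.valRing ↔ ∃ r : ℝ, Germ.LiftPred (fun y : ℝ => |y| < r) (f : RGerm)
  map_deriv : ∀ f : H.toSubring, Φ ⟨derivGerm f, H.deriv_mem f f.2⟩ = E.der (Φ f)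

/-- For every `a ∈ K^{>ℝ}` there is `l ∈ ℤ` such that `log^{[k]}(a) - log^{[k-l]}(x) ∈ 𝓸` for all
sufficiently large `k` (so that in particular `k - l ≥ 0`). -/
def LevelCondition (E : ExponentialHField K) (x : K) : Prop :=
  ∀ a : K, (∀ r : ℝ, algebraMap ℝ K r < a) →
    ∃ l : ℤ, ∀ᶠ k : ℕ in atTop,
      E.logIter k a - E.logIter ((k : ℤ) - l).toNat x ∈ E.valRing.nonunits

end HFields

end GrowthOrder

end

/-!
Write `G` for the group of germs above `ℝ` in the Hardy field, `T r` for the translation `id + r` and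
`e` for the germ of `exp`.

*Centralisers.* If `g` commutes with `f > id`, then `g ≤ f ^ n` for some `n`: an orbit of `f` tends to
infinity, so that `f ^ n > g` holds at one of its points, and commutation propagates this along the
orbit; as germs of a Hardy field are comparable, `f ^ n > g` (`powersCofinal_large`). Hence
centralisers are Archimedean, `f ≼ g` compares `f` with powers of `g`, and the first growth axiom is
immediate.

*Levels.* In `K`, logarithms of infinite elements that differ by an element of `𝒪` differ by an
element of `𝓸`, and `Φ` commutes with `log` up to real constants. So the level condition says about
germs that every `f ∈ G` has some `l ∈ ℤ` for which `f e⁻ˡ` lies in the subgroup `N` of germs that have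
a conjugate by an iterate of `exp` at bounded distance from `id` (`exists_level`). The subgroup `N` is
normal and lies below `e`, so the powers of `e` order the cosets of `N` (`lt_of_level_lt`). Therefore
`e` generates its own centraliser and is scaling, and it represents all growth ranks of elements
outside `N`.

*Level zero.* If `u > id` lies in `N`, then a conjugate of `u` by an iterate of `exp` has the form
`id + δ` with `0 < δ < exp (- exp)` up to a constant factor. The germ `V = - 1 / δ'` satisfies
`V' ∼ 1 / δ`, whence `V ∘ (id + δ) = V + 1 + o(1)` (`exists_approx_abel`): so `u` is conjugate to an
element infinitesimally close to `T 1`. The centraliser of `T 1` consists of the translations, because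
periodic germs in a Hardy field are constant, and every `f ≍ T 1` has a bounded difference with `id`,
hence is close to a translation; thus `T 1` is scaling, and the third axiom follows.

*Second axiom.* If `f > 𝒞(g)`, then `g` must lie in `N`, and after conjugation `g = id + 1 + ε` with
`ε → 0` and `f = id + φ` with `φ → ∞`. The inequality `f g > g f` becomes
`ε ∘ f - ε < φ ∘ g - φ`, which follows from `ε' ≺ (log φ)' = φ' / φ` and `φ'' ≺ φ'`
(`sub_lt_sub_of_tendsto`). All asymptotic estimates rest on the fact that a germ in a Hardy field
that tends to infinity is eventually increasing.
-/

namespace GrowthOrder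

open Filter Set

/-! ### Centralisers in ordered groups -/

section OrderedGroups

variable {G : Type*} [Group G]

theorem mem_centraliser_iff {f g : G} : f ∈ centraliser g ↔ g * f = f * g :=
  Subgroup.mem_centralizer_singleton_iff.trans eq_comm

theorem mem_centraliser_comm {f g : G} : f ∈ centraliser g ↔ g ∈ centraliser f := by
  rw [mem_centraliser_iff, mem_centraliser_iff, eq_comm]

theorem self_mem_centraliser (g : G) : g ∈ centraliser g := mem_centraliser_iff.2 rfl

theorem centraliser_inv (g : G) : centraliser g⁻¹ = centraliser g := by
  ext f
  rw [mem_centraliser_comm, inv_mem_iff, mem_centraliser_comm]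

theorem mem_centraliser_conj {f g h : G} :
    h * f * h⁻¹ ∈ centraliser (h * g * h⁻¹) ↔ f ∈ centraliser g := by
  rw [mem_centraliser_iff, mem_centraliser_iff,
    show h * g * h⁻¹ * (h * f * h⁻¹) = h * (g * f) * h⁻¹ by group,
    show h * f * h⁻¹ * (h * g * h⁻¹) = h * (f * g) * h⁻¹ by group, mul_left_inj, mul_right_inj]

variable [LinearOrder G]

theorem preceq_inv_right {f g : G} : Preceq f g⁻¹ ↔ Preceq f g := by
  simp only [Preceq, centraliser_inv, inv_eq_one, ne_eq]

variable [MulLeftMono G] [MulRightMono G]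

theorem conj_le_conj_iff {f g h : G} : h * f * h⁻¹ ≤ h * g * h⁻¹ ↔ f ≤ g := by simp

theorem preceq_inv_left {f g : G} : Preceq f⁻¹ g ↔ Preceq f g := by
  suffices h : ∀ f : G, Preceq f g → Preceq f⁻¹ g from ⟨fun h' => inv_inv f ▸ h _ h', h f⟩
  rintro f (rfl | ⟨hg, g₀, h₀, g₁, h₁, h₂, h₃⟩)
  · exact Or.inl inv_one
  · exact Or.inr ⟨hg, g₁⁻¹, inv_mem h₁, g₀⁻¹, inv_mem h₀, inv_le_inv_iff.2 h₃,
      inv_le_inv_iff.2 h₂⟩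

theorem asymp_inv_right {f g : G} : Asymp f g⁻¹ ↔ Asymp f g := by
  rw [Asymp, Asymp, preceq_inv_right, preceq_inv_left]

theorem Preceq.conj {f g : G} (h : G) (hfg : Preceq f g) :
    Preceq (h * f * h⁻¹) (h * g * h⁻¹) := by
  rcases hfg with rfl | ⟨hg, g₀, h₀, g₁, h₁, h₂, h₃⟩
  · exact Or.inl (by simp)
  · exact Or.inr ⟨by simpa [mul_inv_eq_one] using hg, _, mem_centraliser_conj.2 h₀, _,
      mem_centraliser_conj.2 h₁, conj_le_conj_iff.2 h₂, conj_le_conj_iff.2 h₃⟩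

theorem preceq_conj_iff {f g h : G} : Preceq (h * f * h⁻¹) (h * g * h⁻¹) ↔ Preceq f g := by
  refine ⟨fun H => ?_, Preceq.conj h⟩
  simpa [mul_assoc] using H.conj h⁻¹

theorem asymp_conj_iff {f g h : G} : Asymp (h * f * h⁻¹) (h * g * h⁻¹) ↔ Asymp f g := by
  rw [Asymp, Asymp, preceq_conj_iff, preceq_conj_iff]

theorem sim_conj_iff {f g h : G} : Sim (h * f * h⁻¹) (h * g * h⁻¹) ↔ Sim f g := by
  rw [Sim, Sim, show h * f * h⁻¹ * (h * g * h⁻¹)⁻¹ = h * (f * g⁻¹) * h⁻¹ by group, Prec, Prec,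
    preceq_conj_iff, asymp_conj_iff]

theorem IsScaling.conj {s : G} (hs : IsScaling s) (h : G) : IsScaling (h * s * h⁻¹) := by
  obtain ⟨h1, hab, hsim⟩ := hs
  have key : ∀ a : G, a = h * (h⁻¹ * a * h) * h⁻¹ := fun a => by group
  refine ⟨?_, ?_, ?_⟩
  · simpa using mul_lt_mul_left (mul_lt_mul_right h1 h) h⁻¹
  · intro a ha b hb
    rw [key a] at ha ⊢
    rw [key b] at hb ⊢
    have := hab _ (mem_centraliser_conj.1 ha) _ (mem_centraliser_conj.1 hb)
    calc _ = h * ((h⁻¹ * a * h) * (h⁻¹ * b * h)) * h⁻¹ := by group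
      _ = h * ((h⁻¹ * b * h) * (h⁻¹ * a * h)) * h⁻¹ := by rw [this]
      _ = _ := by group
  · intro f hf
    rw [key f] at hf ⊢
    obtain ⟨g, hg, hg1, hgf⟩ := hsim _ (asymp_conj_iff.1 hf)
    exact ⟨h * g * h⁻¹, mem_centraliser_conj.2 hg, by simpa [mul_inv_eq_one] using hg1,
      sim_conj_iff.2 hgf⟩

/-- The powers of each `f > 1` are cofinal in the centraliser of `f`. -/
def PowersCofinal (G : Type*) [Group G] [LinearOrder G] : Prop :=
  ∀ f g : G, 1 < f → g ∈ centraliser f → ∃ n : ℕ, g ≤ f ^ n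

section Cofinal

variable (hG : PowersCofinal G)
include hG

omit [MulRightMono G] in
theorem PowersCofinal.exists_le_zpow {f g : G} (hf : f ≠ 1) (hg : g ∈ centraliser f) :
    ∃ n : ℤ, g ≤ f ^ n := by
  rcases lt_or_gt_of_ne hf with h | h
  · obtain ⟨n, hn⟩ := hG f⁻¹ g (one_lt_inv'.2 h) (centraliser_inv f ▸ hg)
    exact ⟨-n, by simpa using hn⟩
  · obtain ⟨n, hn⟩ := hG f g h hg
    exact ⟨n, by simpa using hn⟩

theorem PowersCofinal.exists_zpow_bounds {f u : G} (hf : f ≠ 1) (hfu : Preceq f u) :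
    (∃ n : ℤ, f ≤ u ^ n) ∧ ∃ n : ℤ, f⁻¹ ≤ u ^ n := by
  rcases hfu with rfl | ⟨hu, g₀, h₀, g₁, h₁, h₂, h₃⟩
  · exact absurd rfl hf
  obtain ⟨n, hn⟩ := hG.exists_le_zpow hu h₁
  obtain ⟨m, hm⟩ := hG.exists_le_zpow hu (inv_mem h₀)
  exact ⟨⟨n, h₃.trans hn⟩, m, (inv_le_inv_iff.2 h₂).trans hm⟩

omit [MulRightMono G] in
theorem PowersCofinal.hasArchimedeanCentralisers : HasArchimedeanCentralisers G := by
  rintro g hg ⟨f, hf⟩ ⟨h, hh⟩ hf1 -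
  have hf1 : f ≠ 1 := fun e => hf1 (Subtype.ext e)
  obtain ⟨n, hn⟩ := hG.exists_le_zpow hg hh
  obtain ⟨m, hm⟩ := hG.exists_le_zpow hf1 (zpow_mem (mem_centraliser_comm.1 hf) n)
  exact ⟨m, hn.trans hm⟩

theorem PowersCofinal.gog1 : GOG1 G := by
  intro f g _ hg hgf g₀ hg₀
  obtain ⟨n, hn⟩ := hG g g₀ hg hg₀
  exact ⟨f ^ n, pow_mem (self_mem_centraliser f) n, hn.trans (pow_le_pow_left' hgf n)⟩

end Cofinal

/-! ### Levels -/

section Level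

variable {N : Subgroup G} [N.Normal] {e : G} (hNe : ∀ u ∈ N, u < e)
include hNe

/-- If `N` is a normal subgroup lying below `e`, then the classes of the powers of `e` modulo `N`
are ordered like their exponents. -/
theorem lt_of_level_lt {f g : G} {l m : ℤ} (hf : (f : G ⧸ N) = (e : G ⧸ N) ^ l)
    (hg : (g : G ⧸ N) = (e : G ⧸ N) ^ m) (hlm : l < m) : f < g := by
  have he : 1 < e := hNe 1 N.one_mem
  have hu : (f⁻¹ * g) * (e ^ (m - l))⁻¹ ∈ N := by
    rw [← QuotientGroup.eq_one_iff, QuotientGroup.mk_mul, QuotientGroup.mk_mul,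
      QuotientGroup.mk_inv, QuotientGroup.mk_inv, QuotientGroup.mk_zpow, hf, hg]
    group
  have h1 := hNe _ (N.inv_mem hu)
  have h2 : e ≤ e ^ (m - l) := by
    obtain ⟨n, hn⟩ : ∃ n : ℕ, m - l = n + 1 := ⟨(m - l - 1).toNat, by lia⟩
    rw [hn, zpow_add_one, zpow_natCast]
    exact le_mul_of_one_le_left' (one_le_pow_of_one_le' he.le n)
  have h3 := h1.trans_le h2
  rw [mul_inv_rev, inv_inv, mul_lt_iff_lt_one_left',
    Left.inv_lt_one_iff, lt_inv_mul_iff_lt] at h3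
  exact h3

theorem asymp_of_level_pos {g : G} {l : ℤ} (hl : (g : G ⧸ N) = (e : G ⧸ N) ^ l)
    (hl0 : 0 < l) : Asymp e g := by
  have he : 1 < e := hNe 1 N.one_mem
  have hg : 1 < g := lt_of_level_lt hNe (l := 0) (by simp) hl hl0
  refine ⟨Or.inr ⟨hg.ne', 1, one_mem _, g ^ 2, pow_mem (self_mem_centraliser g) 2, he.le, ?_⟩,
    Or.inr ⟨he.ne', 1, one_mem _, e ^ (l + 1), zpow_mem (self_mem_centraliser e) _, hg.le, ?_⟩⟩
  · refine (lt_of_level_lt hNe (l := 1) (m := l * 2) (zpow_one _).symm ?_ (by lia)).le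
    rw [QuotientGroup.mk_pow, hl, zpow_mul]
    exact (zpow_natCast _ 2).symm
  · exact (lt_of_level_lt hNe hl (QuotientGroup.mk_zpow _ _ _) (by lia)).le

variable (hlev : ∀ f : G, ∃ l : ℤ, (f : G ⧸ N) = (e : G ⧸ N) ^ l)
include hlev

/-- An element of level zero commuting with `e` is trivial: otherwise some power of it would
exceed `e`. -/
theorem exists_zpow_of_mem_centraliser (hG : PowersCofinal G) {f : G} (hf : f ∈ centraliser e) :
    ∃ n : ℤ, f = e ^ n := by
  obtain ⟨l, hl⟩ := hlev f
  refine ⟨l, ?_⟩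
  by_contra hne
  have h1 : f * (e ^ l)⁻¹ ≠ 1 := by rwa [ne_eq, mul_inv_eq_one]
  have h2 : f * (e ^ l)⁻¹ ∈ centraliser e :=
    mul_mem hf (inv_mem (zpow_mem (self_mem_centraliser e) l))
  obtain ⟨n, hn⟩ := hG.exists_le_zpow h1 (mem_centraliser_comm.1 h2)
  refine hn.not_gt (lt_of_level_lt hNe (l := 0) (m := 1) ?_ (zpow_one _).symm one_pos)
  rw [QuotientGroup.mk_zpow, QuotientGroup.mk_mul, QuotientGroup.mk_inv, QuotientGroup.mk_zpow, hl]
  simp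

theorem isScaling_of_level (hG : PowersCofinal G) : IsScaling e := by
  have he : 1 < e := hNe 1 N.one_mem
  refine ⟨he, ?_, ?_⟩
  · intro a ha b hb
    obtain ⟨n, rfl⟩ := exists_zpow_of_mem_centraliser hNe hlev hG ha
    obtain ⟨m, rfl⟩ := exists_zpow_of_mem_centraliser hNe hlev hG hb
    rw [← zpow_add, ← zpow_add, add_comm]
  · rintro f ⟨-, hef⟩
    obtain ⟨l, hl⟩ := hlev f
    have hl0 : l ≠ 0 := by
      rintro rfl
      obtain ⟨⟨n, hn⟩, -⟩ := hG.exists_zpow_bounds he.ne' hef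
      refine hn.not_gt (lt_of_level_lt hNe (l := 0) (m := 1) ?_ (zpow_one _).symm one_pos)
      rw [QuotientGroup.mk_zpow, hl]
      simp
    have he1 : e ^ l ≠ 1 := by
      rcases lt_or_gt_of_ne hl0 with h | h
      · exact (lt_of_level_lt hNe (l := l) (m := 0) (QuotientGroup.mk_zpow _ _ _) (by simp) h).ne
      · exact (lt_of_level_lt hNe (l := 0) (m := l) (by simp) (QuotientGroup.mk_zpow _ _ _) h).ne'
    have hu : ((e ^ l * f⁻¹ : G) : G ⧸ N) = (e : G ⧸ N) ^ (0 : ℤ) := by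
      rw [QuotientGroup.mk_mul, QuotientGroup.mk_inv, QuotientGroup.mk_zpow, hl]
      simp
    refine ⟨e ^ l, zpow_mem (self_mem_centraliser e) l, he1, Or.inr ⟨he1, e ^ (-1 : ℤ), ?_,
      e ^ (1 : ℤ), ?_, ?_, ?_⟩, ?_⟩
    · exact mem_centraliser_comm.1 (zpow_mem (mem_centraliser_comm.1
        (zpow_mem (self_mem_centraliser e) _)) _)
    · exact mem_centraliser_comm.1 (zpow_mem (mem_centraliser_comm.1
        (zpow_mem (self_mem_centraliser e) _)) _)
    · exact (lt_of_level_lt hNe (QuotientGroup.mk_zpow _ _ _) hu (by lia)).le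
    · exact (lt_of_level_lt hNe hu (QuotientGroup.mk_zpow _ _ _) (by lia)).le
    · rintro ⟨h, -⟩
      obtain ⟨⟨n, hn⟩, m, hm⟩ := hG.exists_zpow_bounds he1 h
      have hpow : ∀ n : ℤ, (((e ^ l * f⁻¹) ^ n : G) : G ⧸ N) = (e : G ⧸ N) ^ (0 : ℤ) := by
        intro n
        rw [QuotientGroup.mk_zpow, hu]
        simp
      rcases lt_or_gt_of_ne hl0 with h | h
      · exact hm.not_gt (lt_of_level_lt hNe (hpow m)
          (show ((_ : G) : G ⧸ N) = _ ^ (-l) by simp) (by lia))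
      · exact hn.not_gt (lt_of_level_lt hNe (hpow n) (QuotientGroup.mk_zpow _ _ _) h)

end Level

/-! ### One-parameter subgroups -/

section Translations

/-- For a map `T : ℝ → G`, the element `g` is near `T r` if it lies strictly between `T (r - ε)`
and `T (r + ε)` for all `ε > 0`. -/
def IsNear (T : ℝ → G) (g : G) (r : ℝ) : Prop :=
  ∀ ε > 0, T (r - ε) < g ∧ g < T (r + ε)

omit [Group G] [MulLeftMono G] [MulRightMono G] in
/-- The witness is the supremum of all `r` with `T r ≤ f`. -/
theorem exists_isNear {T : ℝ → G} (hT : StrictMono T) {f : G} {a b : ℝ} (ha : T a ≤ f)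
    (hb : f ≤ T b) : ∃ r, IsNear T f r := by
  have hne : {r | T r ≤ f}.Nonempty := ⟨a, ha⟩
  have hbd : BddAbove {r | T r ≤ f} := ⟨b, fun r hr => hT.le_iff_le.1 (le_trans hr hb)⟩
  refine ⟨sSup {r | T r ≤ f}, fun ε hε => ⟨?_, ?_⟩⟩
  · obtain ⟨r, hr, hlt⟩ := exists_lt_of_lt_csSup hne (sub_lt_self _ hε)
    exact (hT hlt).trans_le hr
  · by_contra! h
    have := le_csSup hbd h
    linarith

variable {T : ℝ → G} (hadd : ∀ r s, T (r + s) = T r * T s)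
include hadd

omit [LinearOrder G] [MulLeftMono G] [MulRightMono G] in
theorem translation_zero : T 0 = 1 := by
  have := hadd 0 0
  rwa [add_zero, left_eq_mul] at this

omit [LinearOrder G] [MulLeftMono G] [MulRightMono G] in
theorem translation_neg (r : ℝ) : T (-r) = (T r)⁻¹ := by
  rw [eq_inv_iff_mul_eq_one, ← hadd, neg_add_cancel, translation_zero hadd]

omit [LinearOrder G] [MulLeftMono G] [MulRightMono G] in
theorem translation_mem_centraliser (r s : ℝ) : T r ∈ centraliser (T s) := by
  rw [mem_centraliser_iff, ← hadd, ← hadd, add_comm]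

theorem IsNear.mul {f g : G} {r s : ℝ} (hf : IsNear T f r) (hg : IsNear T g s) :
    IsNear T (f * g) (r + s) := by
  intro ε hε
  have h1 := hf (ε / 2) (by linarith)
  have h2 := hg (ε / 2) (by linarith)
  rw [show r + s - ε = (r - ε / 2) + (s - ε / 2) by ring,
    show r + s + ε = (r + ε / 2) + (s + ε / 2) by ring, hadd, hadd]
  exact ⟨mul_lt_mul_of_lt_of_lt h1.1 h2.1, mul_lt_mul_of_lt_of_lt h1.2 h2.2⟩

theorem IsNear.inv {f : G} {r : ℝ} (hf : IsNear T f r) : IsNear T f⁻¹ (-r) := by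
  intro ε hε
  obtain ⟨h1, h2⟩ := hf ε hε
  rw [show -r - ε = -(r + ε) by ring, show -r + ε = -(r - ε) by ring, translation_neg hadd,
    translation_neg hadd]
  exact ⟨inv_lt_inv_iff.2 h2, inv_lt_inv_iff.2 h1⟩

theorem IsNear.pow (hT : StrictMono T) {f : G} {r : ℝ} (hf : IsNear T f r) (n : ℕ) :
    IsNear T (f ^ n) (n * r) := by
  induction n with
  | zero =>
    intro ε hε
    rw [pow_zero, ← translation_zero hadd]
    exact ⟨hT (by simpa using hε), hT (by simpa using hε)⟩
  | succ n ih =>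
    rw [pow_succ, Nat.cast_succ, add_one_mul]
    exact ih.mul hadd hf

theorem IsNear.zpow_zero (hT : StrictMono T) {f : G} (hf : IsNear T f 0) (n : ℤ) :
    IsNear T (f ^ n) 0 := by
  obtain ⟨m, rfl | rfl⟩ := n.eq_nat_or_neg
  · simpa using hf.pow hadd hT m
  · simpa using (hf.pow hadd hT m).inv hadd

theorem not_preceq_of_isNear_zero (hG : PowersCofinal G) (hT : StrictMono T) {u : G} {r : ℝ}
    (hr : r ≠ 0) (hu : IsNear T u 0) : ¬ Preceq (T r) u := by
  have hr1 : T r ≠ 1 := by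
    rw [← translation_zero hadd]
    exact hT.injective.ne hr
  intro h
  obtain ⟨⟨n, hn⟩, m, hm⟩ := hG.exists_zpow_bounds hr1 h
  rcases lt_or_gt_of_ne hr with h | h
  · have := (hu.zpow_zero hadd hT m (-r) (by linarith)).2
    rw [zero_add, translation_neg hadd] at this
    exact hm.not_gt this
  · have := (hu.zpow_zero hadd hT n r h).2
    rw [zero_add] at this
    exact hn.not_gt this

theorem isScaling_translation (hG : PowersCofinal G) (hT : StrictMono T)
    (hC : ∀ f ∈ centraliser (T 1), ∃ r, f = T r) : IsScaling (T 1) := by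
  have h0 := translation_zero hadd
  have h1 : 1 < T 1 := h0 ▸ hT one_pos
  refine ⟨h1, ?_, ?_⟩
  · intro a ha b hb
    obtain ⟨r, rfl⟩ := hC a ha
    obtain ⟨s, rfl⟩ := hC b hb
    rw [← hadd, ← hadd, add_comm]
  · rintro f ⟨hf, hf'⟩
    obtain ⟨r, hr⟩ : ∃ r, IsNear T f r := by
      rcases hf with rfl | ⟨-, g₀, hg₀, g₁, hg₁, h₂, h₃⟩
      · rw [← h0]
        exact exists_isNear hT le_rfl le_rfl
      · obtain ⟨a, rfl⟩ := hC _ hg₀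
        obtain ⟨b, rfl⟩ := hC _ hg₁
        exact exists_isNear hT h₂ h₃
    have hr0 : r ≠ 0 := by
      rintro rfl
      exact not_preceq_of_isNear_zero hadd hG hT one_ne_zero hr hf'
    have hr1 : T r ≠ 1 := by
      rw [← h0]
      exact hT.injective.ne hr0
    have hu : IsNear T (T r * f⁻¹) 0 := by
      have h := IsNear.mul hadd (f := T r) (r := r)
        (fun ε hε => ⟨hT (by linarith), hT (by linarith)⟩) (hr.inv hadd)
      rwa [add_neg_cancel] at h
    refine ⟨T r, translation_mem_centraliser hadd _ _, hr1, Or.inr ⟨hr1, T (0 - 1),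
      translation_mem_centraliser hadd _ _, T (0 + 1), translation_mem_centraliser hadd _ _,
      (hu 1 one_pos).1.le, (hu 1 one_pos).2.le⟩, fun h => ?_⟩
    exact not_preceq_of_isNear_zero hadd hG hT hr0 hu h.1

theorem asymp_of_isNear_one (hT : StrictMono T) {g : G} (hg : IsNear T g 1) : Asymp (T 1) g := by
  have h0 := translation_zero hadd
  have h1 : 1 < T 1 := h0 ▸ hT one_pos
  have hg1 : 1 < g := by
    have := (hg 1 one_pos).1
    rwa [sub_self, h0] at this
  refine ⟨Or.inr ⟨hg1.ne', 1, one_mem _, g ^ 2, pow_mem (self_mem_centraliser g) 2, h1.le, ?_⟩,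
    Or.inr ⟨h1.ne', 1, one_mem _, T (1 + 1), translation_mem_centraliser hadd _ _, hg1.le,
      (hg 1 one_pos).2.le⟩⟩
  have := (hg.pow hadd hT 2 1 one_pos).1.le
  norm_num at this
  exact this

end Translations

/-! ### A criterion for growth order groups -/

/-- Criterion for growth order groups: every element is, modulo a normal subgroup `N` below `e`, a
power of `e`, and every `u > 1` in `N` is conjugate to an element near `T 1`, where `T` is a
one-parameter subgroup that is the centraliser of `T 1`. -/
theorem isGrowthOrderGroup_of_level (hG : PowersCofinal G) {N : Subgroup G} [N.Normal] {e : G}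
    (hNe : ∀ u ∈ N, u < e) (hlev : ∀ f : G, ∃ l : ℤ, (f : G ⧸ N) = (e : G ⧸ N) ^ l)
    {T : ℝ → G} (hadd : ∀ r s, T (r + s) = T r * T s) (hT : StrictMono T)
    (hC : ∀ f ∈ centraliser (T 1), ∃ r, f = T r)
    (hconj : ∀ u ∈ N, 1 < u → ∃ h, IsNear T (h * u * h⁻¹) 1)
    (hcomm : ∀ f g : G, IsNear T g 1 → (∀ r, T r < f) → g * f < f * g) :
    IsGrowthOrderGroup G where
  ordered f g h hgh := ⟨mul_lt_mul_right hgh f, mul_lt_mul_left hgh f⟩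
  gog1 := hG.gog1
  gog2 := by
    intro f g hf hg hfg
    obtain ⟨l, hl⟩ := hlev g
    have hfg' : ∀ n : ℕ, g ^ n < f := fun n => hfg _ (pow_mem (self_mem_centraliser g) n)
    rcases lt_trichotomy l 0 with h0 | rfl | h0
    · exact absurd hg (lt_of_level_lt hNe hl (m := 0) (by simp) h0).not_gt
    · obtain ⟨h, hh⟩ := hconj g (by simpa using hl) hg
      have hlt := hcomm (h * f * h⁻¹) _ hh fun r => ?_
      · have : h * (g * f) * h⁻¹ < h * (f * g) * h⁻¹ := by
          convert hlt using 1 <;> group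
        simpa using this
      · obtain ⟨n, hn⟩ := exists_nat_gt (r + 1)
        have h1 := (hh.pow hadd hT n 1 one_pos).1
        have h2 : (h * g * h⁻¹) ^ n < h * f * h⁻¹ := by
          rw [conj_pow]
          exact mul_lt_mul_left (mul_lt_mul_right (hfg' n) h) h⁻¹
        exact (hT (by linarith)).trans (h1.trans h2)
    · -- the powers of `g` exceed every level, so that `f > 𝒞(g)` is impossible
      exfalso
      obtain ⟨m, hm⟩ := hlev f
      refine (hfg' (m.toNat + 1)).not_gt (lt_of_level_lt hNe hm (m := l * (m.toNat + 1 : ℕ)) ?_ ?_)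
      · rw [QuotientGroup.mk_pow, hl, zpow_mul, zpow_natCast]
      · have : m ≤ m.toNat := Int.self_le_toNat m
        push_cast
        nlinarith
  gog3 := by
    have main : ∀ g : G, 1 < g → ∃ s : G, Asymp s g ∧ IsScaling s := by
      intro g hg
      obtain ⟨l, hl⟩ := hlev g
      rcases lt_trichotomy l 0 with h0 | rfl | h0
      · exact absurd hg (lt_of_level_lt hNe hl (m := 0) (by simp) h0).not_gt
      · obtain ⟨h, hh⟩ := hconj g (by simpa using hl) hg
        refine ⟨h⁻¹ * T 1 * h⁻¹⁻¹, ?_, (isScaling_translation hadd hG hT hC).conj _⟩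
        rw [← asymp_conj_iff (h := h)]
        convert asymp_of_isNear_one hadd hT hh using 1
        group
      · exact ⟨e, asymp_of_level_pos hNe hl h0, isScaling_of_level hNe hlev hG⟩
    intro g hg
    rcases lt_or_gt_of_ne hg with h | h
    · obtain ⟨s, hs, hs'⟩ := main g⁻¹ (one_lt_inv'.2 h)
      exact ⟨s, asymp_inv_right.1 hs, hs'⟩
    · exact main g h

end OrderedGroups

/-! ### Functions representing germs of a Hardy field -/

section HardyFunctions

/-- The germ at `+∞` of the function `u` lies in the Hardy field `H`. -/
def HardyField.MemFun (H : HardyField) (u : ℝ → ℝ) : Prop := (u : RGerm) ∈ H.carrier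

variable {H : HardyField} {u v : ℝ → ℝ}

namespace HardyField.MemFun

theorem congr (hu : H.MemFun u) (h : u =ᶠ[atTop] v) : H.MemFun v := by
  rw [MemFun, ← Germ.coe_eq.2 h]
  exact hu

theorem const (r : ℝ) : H.MemFun fun _ => r := H.const_mem r

theorem add (hu : H.MemFun u) (hv : H.MemFun v) : H.MemFun fun t => u t + v t :=
  H.toSubring.add_mem hu hv

theorem sub (hu : H.MemFun u) (hv : H.MemFun v) : H.MemFun fun t => u t - v t :=
  H.toSubring.sub_mem hu hv

theorem mul (hu : H.MemFun u) (hv : H.MemFun v) : H.MemFun fun t => u t * v t :=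
  H.toSubring.mul_mem hu hv

theorem neg (hu : H.MemFun u) : H.MemFun fun t => -u t := H.toSubring.neg_mem hu

theorem inv (hu : H.MemFun u) : H.MemFun fun t => (u t)⁻¹ := by
  by_cases h0 : (u : RGerm) = 0
  · have h : u =ᶠ[atTop] fun _ => (0 : ℝ) := Germ.coe_eq.1 h0
    refine hu.congr ?_
    filter_upwards [h] with t ht
    simp [ht]
  · obtain ⟨w, hw, huw⟩ := H.exists_inv _ hu h0
    induction w using Germ.inductionOn with
    | _ w =>
      have h : (fun t => u t * w t) =ᶠ[atTop] fun _ => (1 : ℝ) := Germ.coe_eq.1 huw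
      refine congr hw ?_
      filter_upwards [h] with t ht
      exact eq_inv_of_mul_eq_one_right ht

theorem deriv (hu : H.MemFun u) : H.MemFun (deriv u) := H.deriv_mem _ hu

theorem eventually_differentiableAt (hu : H.MemFun u) : ∀ᶠ t in atTop, DifferentiableAt ℝ u t := by
  obtain ⟨w, hw, hk⟩ := H.smooth _ hu
  obtain ⟨a, ha⟩ := hk 1
  obtain ⟨b, hb⟩ := eventually_atTop.1 (Germ.coe_eq.1 hw)
  filter_upwards [eventually_gt_atTop a, eventually_gt_atTop b] with t hta htb
  have h1 : DifferentiableAt ℝ w t :=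
    (ha.differentiableOn (by simp)).differentiableAt (Ioi_mem_nhds hta)
  refine h1.congr_of_eventuallyEq ?_
  filter_upwards [Ioi_mem_nhds htb] with s hs using (hb s (le_of_lt hs)).symm

theorem trichotomy (hu : H.MemFun u) (hv : H.MemFun v) :
    (∀ᶠ t in atTop, u t < v t) ∨ u =ᶠ[atTop] v ∨ ∀ᶠ t in atTop, v t < u t := by
  rcases H.evLT_trichotomy hu hv with h | h | h
  · exact Or.inl (Germ.liftRel_coe.1 h)
  · exact Or.inr (Or.inl (Germ.coe_eq.1 h))
  · exact Or.inr (Or.inr (Germ.liftRel_coe.1 h))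

theorem eventually_lt_or_le (hu : H.MemFun u) (hv : H.MemFun v) :
    (∀ᶠ t in atTop, u t < v t) ∨ ∀ᶠ t in atTop, v t ≤ u t := by
  rcases hu.trichotomy hv with h | h | h
  · exact Or.inl h
  · exact Or.inr (h.mono fun t ht => ht.ge)
  · exact Or.inr (h.mono fun t ht => ht.le)

/-- The mean value theorem, on all intervals sufficiently far out. -/
theorem eventually_exists_deriv (hu : H.MemFun u) :
    ∀ᶠ a in atTop, ∀ s t, a ≤ s → s < t →
      ∃ c, s < c ∧ c < t ∧ u t - u s = _root_.deriv u c * (t - s) := by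
  obtain ⟨b, hb⟩ := eventually_atTop.1 hu.eventually_differentiableAt
  filter_upwards [eventually_ge_atTop b] with a ha s t hs hst
  have hd : ∀ x ∈ Icc s t, DifferentiableAt ℝ u x := fun x hx => hb x (by linarith [hx.1])
  obtain ⟨c, hc, h⟩ := exists_deriv_eq_slope u hst
    (fun x hx => (hd x hx).continuousAt.continuousWithinAt)
    (fun x hx => (hd x (Ioo_subset_Icc_self hx)).differentiableWithinAt)
  refine ⟨c, hc.1, hc.2, ?_⟩
  rw [h, div_mul_cancel₀ _ (sub_pos.2 hst).ne']

theorem eventually_strictMonoOn (hu : H.MemFun u) (h : ∀ᶠ t in atTop, 0 < _root_.deriv u t) :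
    ∀ᶠ a in atTop, StrictMonoOn u (Ici a) := by
  filter_upwards [hu.eventually_exists_deriv, eventually_forall_ge_atTop.2 h] with a ha hd
    s hs t _ hst
  obtain ⟨c, hc, -, h⟩ := ha s t hs hst
  have := mul_pos (hd c (le_trans hs hc.le)) (sub_pos.2 hst)
  linarith

theorem eventually_strictAntiOn (hu : H.MemFun u) (h : ∀ᶠ t in atTop, _root_.deriv u t < 0) :
    ∀ᶠ a in atTop, StrictAntiOn u (Ici a) := by
  filter_upwards [hu.eventually_exists_deriv, eventually_forall_ge_atTop.2 h] with a ha hd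
    s hs t _ hst
  obtain ⟨c, hc, -, h⟩ := ha s t hs hst
  have := mul_neg_of_neg_of_pos (hd c (le_trans hs hc.le)) (sub_pos.2 hst)
  linarith

theorem eventually_monotoneOn (hu : H.MemFun u) (h : ∀ᶠ t in atTop, 0 ≤ _root_.deriv u t) :
    ∀ᶠ a in atTop, MonotoneOn u (Ici a) := by
  filter_upwards [hu.eventually_exists_deriv, eventually_forall_ge_atTop.2 h] with a ha hd
    s hs t _ hst
  rcases hst.eq_or_lt with rfl | hst
  · exact le_rfl
  obtain ⟨c, hc, -, h⟩ := ha s t hs hst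
  have := mul_nonneg (hd c (le_trans hs hc.le)) (sub_pos.2 hst).le
  linarith

theorem eventually_antitoneOn (hu : H.MemFun u) (h : ∀ᶠ t in atTop, _root_.deriv u t ≤ 0) :
    ∀ᶠ a in atTop, AntitoneOn u (Ici a) := by
  filter_upwards [hu.eventually_exists_deriv, eventually_forall_ge_atTop.2 h] with a ha hd
    s hs t _ hst
  rcases hst.eq_or_lt with rfl | hst
  · exact le_rfl
  obtain ⟨c, hc, -, h⟩ := ha s t hs hst
  have := mul_nonpos_of_nonpos_of_nonneg (hd c (le_trans hs hc.le)) (sub_pos.2 hst).le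
  linarith

theorem deriv_pos_of_tendsto_atTop (hu : H.MemFun u) (h : Tendsto u atTop atTop) :
    ∀ᶠ t in atTop, 0 < _root_.deriv u t := by
  rcases (const 0).eventually_lt_or_le hu.deriv with h' | h'
  · exact h'
  · obtain ⟨a, ha⟩ := (hu.eventually_antitoneOn h').exists
    obtain ⟨t, ht, hta⟩ := ((h.eventually_gt_atTop (u a)).and (eventually_ge_atTop a)).exists
    exact absurd (ha self_mem_Ici hta hta) ht.not_ge

theorem deriv_neg_of_tendsto_zero (hu : H.MemFun u) (hpos : ∀ᶠ t in atTop, 0 < u t)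
    (h : Tendsto u atTop (nhds 0)) : ∀ᶠ t in atTop, _root_.deriv u t < 0 := by
  rcases hu.deriv.eventually_lt_or_le (const 0) with h' | h'
  · exact h'
  · obtain ⟨a, ha, ha0⟩ := ((hu.eventually_monotoneOn h').and hpos).exists
    obtain ⟨t, ht, hta⟩ := ((h.eventually_lt_const ha0).and (eventually_ge_atTop a)).exists
    exact absurd (ha self_mem_Ici hta hta) ht.not_ge

/-- If `u → 0` and `v → ∞`, then `u' ≺ v'`: otherwise `c v + u` or `c v - u` would tend to `∞`
without being eventually increasing. -/
theorem abs_deriv_lt (hu : H.MemFun u) (hv : H.MemFun v) (h : Tendsto u atTop (nhds 0))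
    (h' : Tendsto v atTop atTop) {c : ℝ} (hc : 0 < c) :
    ∀ᶠ t in atTop, |_root_.deriv u t| < c * _root_.deriv v t := by
  have h1 := (((const c).mul hv).add hu).deriv_pos_of_tendsto_atTop
    ((h'.const_mul_atTop hc).atTop_add h)
  have h2 := (((const c).mul hv).add hu.neg).deriv_pos_of_tendsto_atTop
    ((h'.const_mul_atTop hc).atTop_add h.neg)
  filter_upwards [h1, h2, hu.eventually_differentiableAt, hv.eventually_differentiableAt]
    with t h1 h2 hu hv
  rw [deriv_fun_add (hv.const_mul c) hu, deriv_const_mul c hv] at h1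
  rw [deriv_fun_add (hv.const_mul c) hu.fun_neg, deriv_const_mul c hv, deriv.fun_neg] at h2
  exact abs_lt.2 ⟨by linarith, by linarith⟩

theorem tendsto_deriv_zero (hid : H.MemFun fun t => t) (hu : H.MemFun u)
    (h : Tendsto u atTop (nhds 0)) : Tendsto (_root_.deriv u) atTop (nhds 0) := by
  rw [Metric.tendsto_nhds]
  intro ε hε
  filter_upwards [hu.abs_deriv_lt hid h tendsto_id hε] with t ht
  simpa using ht

end HardyField.MemFun

theorem HardyFieldCompInv.comp_memFun (H : HardyFieldCompInv) {u v : ℝ → ℝ} (hu : H.MemFun u)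
    (hv : H.MemFun v) (h : Tendsto v atTop atTop) : H.MemFun fun t => u (v t) :=
  H.comp_mem _ hu _ hv (aboveReals_coe.2 h)

end HardyFunctions

/-! ### Representatives of the elements of the group -/

section Representatives

variable {H : ExpHardyField}

/-- The function `u` represents the germ `f`. -/
def IsRep (f : H.Large) (u : ℝ → ℝ) : Prop := f.1 = (u : RGerm)

theorem exists_isRep (f : H.Large) : ∃ u, IsRep f u := by
  obtain ⟨f, hf⟩ := f
  induction f using Germ.inductionOn with
  | _ u => exact ⟨u, rfl⟩

/-- The element of the group represented by a function that tends to `∞`. -/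
def ExpHardyField.ofFun (H : ExpHardyField) (u : ℝ → ℝ) (hu : H.MemFun u)
    (h : Tendsto u atTop atTop) : H.Large :=
  ⟨u, hu, aboveReals_coe.2 h⟩

theorem isRep_ofFun {u : ℝ → ℝ} (hu : H.MemFun u) (h : Tendsto u atTop atTop) :
    IsRep (H.ofFun u hu h) u := rfl

theorem isRep_one : IsRep (1 : H.Large) fun t => t := rfl

theorem ExpHardyField.memFun_id (H : ExpHardyField) : H.MemFun fun t => t := H.id_mem

theorem ExpHardyField.memFun_exp (H : ExpHardyField) : H.MemFun Real.exp := H.exp_mem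

namespace IsRep

variable {f g : H.Large} {u v : ℝ → ℝ}

theorem memFun (hf : IsRep f u) : H.MemFun u := by
  have := f.2.1
  rwa [hf] at this

theorem tendsto (hf : IsRep f u) : Tendsto u atTop atTop := by
  have := f.2.2
  rwa [hf, aboveReals_coe] at this

theorem mul (hf : IsRep f u) (hg : IsRep g v) : IsRep (f * g) fun t => u (v t) := by
  obtain ⟨f, hf'⟩ := f
  obtain ⟨g, hg'⟩ := g
  obtain rfl : f = u := hf
  obtain rfl : g = v := hg
  rfl

theorem pow (hf : IsRep f u) (n : ℕ) : IsRep (f ^ n) u^[n] := by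
  induction n with
  | zero => exact isRep_one
  | succ n ih =>
    rw [pow_succ, Function.iterate_succ]
    exact ih.mul hf

theorem lt_iff (hf : IsRep f u) (hg : IsRep g v) : f < g ↔ ∀ᶠ t in atTop, u t < v t := by
  change EvLT f.1 g.1 ↔ _
  rw [hf, hg]
  exact Germ.liftRel_coe

theorem eq_iff (hf : IsRep f u) (hg : IsRep g v) : f = g ↔ u =ᶠ[atTop] v := by
  rw [← Germ.coe_eq, ← hf, ← hg]
  exact ⟨fun h => h ▸ rfl, Subtype.ext⟩

theorem eventually_strictMonoOn (hf : IsRep f u) : ∀ᶠ a in atTop, StrictMonoOn u (Ici a) :=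
  hf.memFun.eventually_strictMonoOn (hf.memFun.deriv_pos_of_tendsto_atTop hf.tendsto)

theorem lt_of_frequently (hf : IsRep f u) (hg : IsRep g v) (h : ∃ᶠ t in atTop, u t < v t) :
    f < g := by
  rcases lt_trichotomy f g with h' | h' | h'
  · exact h'
  · obtain ⟨t, h1, h2⟩ := (h.and_eventually ((hf.eq_iff hg).1 h')).exists
    exact absurd h2 h1.ne
  · obtain ⟨t, h1, h2⟩ := (h.and_eventually ((hg.lt_iff hf).1 h')).exists
    exact absurd h2 h1.not_gt

theorem eq_of_frequently (hf : IsRep f u) (hg : IsRep g v) (h : ∃ᶠ t in atTop, u t = v t) :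
    f = g := by
  rcases lt_trichotomy f g with h' | h' | h'
  · obtain ⟨t, h1, h2⟩ := (h.and_eventually ((hf.lt_iff hg).1 h')).exists
    exact absurd h1 h2.ne
  · exact h'
  · obtain ⟨t, h1, h2⟩ := (h.and_eventually ((hg.lt_iff hf).1 h')).exists
    exact absurd h1 h2.ne'

end IsRep

theorem mul_lt_mul_of_lt_right_large {f g h : H.Large} (hgh : h < g) : f * h < f * g := by
  obtain ⟨u, hu⟩ := exists_isRep f
  obtain ⟨v, hv⟩ := exists_isRep g
  obtain ⟨w, hw⟩ := exists_isRep h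
  rw [(hu.mul hw).lt_iff (hu.mul hv)]
  obtain ⟨a, ha⟩ := hu.eventually_strictMonoOn.exists
  filter_upwards [(hw.lt_iff hv).1 hgh, hv.tendsto.eventually_ge_atTop a,
    hw.tendsto.eventually_ge_atTop a] with t h1 h2 h3 using ha h3 h2 h1

theorem mul_lt_mul_of_lt_left_large {f g h : H.Large} (hgh : h < g) : h * f < g * f := by
  obtain ⟨u, hu⟩ := exists_isRep f
  obtain ⟨v, hv⟩ := exists_isRep g
  obtain ⟨w, hw⟩ := exists_isRep h
  rw [(hw.mul hu).lt_iff (hv.mul hu)]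
  exact hu.tendsto.eventually ((hw.lt_iff hv).1 hgh)

instance : MulLeftMono H.Large where
  elim f g h hgh := by
    rcases hgh.eq_or_lt with rfl | hgh
    · exact le_rfl
    · exact (mul_lt_mul_of_lt_right_large hgh).le

instance : MulRightMono H.Large where
  elim f g h hgh := by
    rcases hgh.eq_or_lt with rfl | hgh
    · exact le_rfl
    · exact (mul_lt_mul_of_lt_left_large hgh).le

theorem tendsto_iterate_atTop {u : ℝ → ℝ} {a : ℝ} (hu : ∀ t ≥ a, t < u t)
    (hc : ∀ t ≥ a, ContinuousAt u t) : Tendsto (fun n => u^[n] a) atTop atTop := by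
  have hge : ∀ n, a ≤ u^[n] a := by
    intro n
    induction n with
    | zero => exact le_rfl
    | succ n ih =>
      rw [Function.iterate_succ_apply']
      exact ih.trans (hu _ ih).le
  have hmono : Monotone fun n => u^[n] a := monotone_nat_of_le_succ fun n => by
    rw [Function.iterate_succ_apply']
    exact (hu _ (hge n)).le
  rcases tendsto_atTop_of_monotone hmono with h | ⟨l, hl⟩
  · exact h
  · have hal : a ≤ l := ge_of_tendsto' hl hge
    have hfix := isFixedPt_of_tendsto_iterate hl (hc l hal)
    exact absurd hfix (hu l hal).ne'

/-- If `g` commutes with `f > id`, then `f ^ n > g` at one point of an orbit of `f` implies the same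
at all later points of that orbit, hence as germs. -/
theorem powersCofinal_large : PowersCofinal H.Large := by
  intro f g hf hg
  obtain ⟨u, hu⟩ := exists_isRep f
  obtain ⟨v, hv⟩ := exists_isRep g
  have h1 : ∀ᶠ t in atTop, t < u t := (isRep_one.lt_iff hu).1 hf
  have h2 : ∀ᶠ t in atTop, u (v t) = v (u t) :=
    ((hu.mul hv).eq_iff (hv.mul hu)).1 (mem_centraliser_iff.1 hg)
  obtain ⟨a, ha, hmono⟩ := ((eventually_forall_ge_atTop.2 (h1.and
    (hu.memFun.eventually_differentiableAt.and h2))).and hu.eventually_strictMonoOn).exists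
  obtain ⟨b, hba, hb⟩ := ((eventually_ge_atTop a).and (hv.tendsto.eventually_ge_atTop a)).exists
  have horb := tendsto_iterate_atTop (a := b) (fun t ht => (ha t (hba.trans ht)).1)
    fun t ht => (ha t (hba.trans ht)).2.1.continuousAt
  obtain ⟨n, hn⟩ := (horb.eventually_gt_atTop (v b)).exists
  have hmaps : ∀ t, a ≤ t → a ≤ u t := fun t ht => ht.trans (ha t ht).1.le
  have hiter : ∀ m t, a ≤ t → a ≤ u^[m] t := by
    intro m
    induction m with
    | zero => exact fun t ht => ht
    | succ m ih => exact fun t ht => ih _ (hmaps t ht)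
  have key : ∀ m, u^[m] (v b) < u^[m] (u^[n] b) ∧ u^[m] (v b) = v (u^[m] b) ∧
      a ≤ u^[m] (v b) := by
    intro m
    induction m with
    | zero => exact ⟨hn, rfl, hb⟩
    | succ m ih =>
      simp only [Function.iterate_succ_apply']
      exact ⟨hmono ih.2.2 (ih.2.2.trans ih.1.le) ih.1,
        by rw [ih.2.1, (ha _ (hiter m b hba)).2.2], hmaps _ ih.2.2⟩
  refine ⟨n, (hv.lt_of_frequently (hu.pow n) (horb.frequently
    (Frequently.of_forall fun m => ?_))).le⟩
  rw [← (key m).2.1, ← Function.iterate_add_apply, add_comm, Function.iterate_add_apply]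
  exact (key m).1

end Representatives

/-! ### Translations -/

section TranslationGerms

variable {H : ExpHardyField}

theorem ExpHardyField.memFun_add_const (H : ExpHardyField) (r : ℝ) : H.MemFun fun t => t + r :=
  H.memFun_id.add (HardyField.MemFun.const r)

/-- The germ of `t ↦ t + r` as an element of the group. -/
def ExpHardyField.translation (H : ExpHardyField) (r : ℝ) : H.Large :=
  H.ofFun (fun t => t + r) (H.memFun_add_const r) (tendsto_atTop_add_const_right _ r tendsto_id)

theorem isRep_translation (r : ℝ) : IsRep (H.translation r) fun t => t + r := rfl

theorem translation_add (r s : ℝ) :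
    H.translation (r + s) = H.translation r * H.translation s := by
  rw [(isRep_translation _).eq_iff ((isRep_translation r).mul (isRep_translation s))]
  exact Eventually.of_forall fun t => by ring

theorem translation_strictMono : StrictMono H.translation := by
  intro r s hrs
  rw [(isRep_translation r).lt_iff (isRep_translation s)]
  exact Eventually.of_forall fun t => by simpa using hrs

/-- If `f` commutes with `id + 1`, then `f - id` is periodic, hence agrees with a constant at
arbitrarily large arguments. -/
theorem exists_eq_translation {f : H.Large} (hf : f ∈ centraliser (H.translation 1)) :
    ∃ r, f = H.translation r := by
  obtain ⟨u, hu⟩ := exists_isRep f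
  have h := (((isRep_translation 1).mul hu).eq_iff (hu.mul (isRep_translation 1))).1
    (mem_centraliser_iff.1 hf)
  obtain ⟨a, ha⟩ := eventually_atTop.1 h
  refine ⟨u a - a, hu.eq_of_frequently (isRep_translation _) ?_⟩
  have hn : ∀ n : ℕ, u (a + n) = a + n + (u a - a) := by
    intro n
    induction n with
    | zero => simp
    | succ n ih =>
      have : u (a + n) + 1 = u (a + n + 1) := ha (a + n) (by simp)
      push_cast
      rw [← add_assoc, ← this, ih]
      ring
  exact (tendsto_atTop_add_const_left _ a tendsto_natCast_atTop_atTop).frequently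
    (Frequently.of_forall hn)

theorem IsNear.tendsto_sub {g : H.Large} {u : ℝ → ℝ} {r : ℝ} (hg : IsRep g u)
    (h : IsNear H.translation g r) : Tendsto (fun t => u t - t) atTop (nhds r) := by
  rw [Metric.tendsto_nhds]
  intro ε hε
  obtain ⟨h1, h2⟩ := h ε hε
  filter_upwards [((isRep_translation _).lt_iff hg).1 h1,
    (hg.lt_iff (isRep_translation _)).1 h2] with t h1 h2
  rw [Real.dist_eq, abs_lt]
  constructor <;> linarith

theorem isNear_conj_of_tendsto {g h : H.Large} {u V : ℝ → ℝ} {r : ℝ} (hg : IsRep g u)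
    (hh : IsRep h V) (hlim : Tendsto (fun t => V (u t) - V t) atTop (nhds r)) :
    IsNear H.translation (h * g * h⁻¹) r := by
  intro ε hε
  rw [lt_mul_inv_iff_mul_lt, mul_inv_lt_iff_lt_mul,
    ((isRep_translation _).mul hh).lt_iff (hh.mul hg),
    (hh.mul hg).lt_iff ((isRep_translation _).mul hh)]
  have := Metric.tendsto_nhds.1 hlim ε hε
  constructor <;> filter_upwards [this] with t ht <;> rw [Real.dist_eq, abs_lt] at ht <;>
    linarith

end TranslationGerms

/-! ### Conjugating germs near the identity to translations -/

section Abel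

variable {H : ExpHardyField}

theorem ExpHardyField.memFun_exp_mul (H : ExpHardyField) {c : ℝ} (hc : 0 < c) :
    H.MemFun fun t => Real.exp (c * t) :=
  H.comp_memFun H.memFun_exp ((HardyField.MemFun.const c).mul H.memFun_id)
    (tendsto_id.const_mul_atTop hc)

/-- A positive germ decaying faster than all `exp (- c t)` satisfies `δ' < - c δ`. -/
theorem deriv_lt_neg_mul {δ : ℝ → ℝ} (hδ : H.MemFun δ) (hpos : ∀ᶠ t in atTop, 0 < δ t) {c : ℝ}
    (hc : 0 < c) (hlim : Tendsto (fun t => δ t * Real.exp (c * t)) atTop (nhds 0)) :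
    ∀ᶠ t in atTop, deriv δ t < -(c * δ t) := by
  have h := (hδ.mul (H.memFun_exp_mul hc)).deriv_neg_of_tendsto_zero
    (hpos.mono fun t ht => mul_pos ht (Real.exp_pos _)) hlim
  filter_upwards [h, hδ.eventually_differentiableAt] with t ht hd
  have he : HasDerivAt (fun t => Real.exp (c * t)) (Real.exp (c * t) * c) t := by
    simpa using ((hasDerivAt_id t).const_mul c).exp
  rw [(hd.hasDerivAt.fun_mul he).deriv] at ht
  have hx := Real.exp_pos (c * t)
  by_contra! hcon
  nlinarith

/-- An approximate solution of Abel's equation: if `δ > 0` decays faster than every `exp (- c t)`,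
then `V = - 1 / δ'` satisfies `V' ∼ 1 / δ`, because `(δ / δ')' → 0`; hence
`V (t + δ t) - V t → 1`. -/
theorem exists_approx_abel {δ : ℝ → ℝ} (hδ : H.MemFun δ) (hpos : ∀ᶠ t in atTop, 0 < δ t)
    (hlim : ∀ c > 0, Tendsto (fun t => δ t * Real.exp (c * t)) atTop (nhds 0)) :
    ∃ V : ℝ → ℝ, H.MemFun V ∧ Tendsto V atTop atTop ∧
      Tendsto (fun t => V (t + δ t) - V t) atTop (nhds 1) := by
  have hδ0 : Tendsto δ atTop (nhds 0) := by
    refine squeeze_zero' (hpos.mono fun t h => h.le) ?_ (hlim 1 one_pos)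
    filter_upwards [hpos, eventually_ge_atTop 0] with t ht h0
    exact le_mul_of_one_le_right ht.le (Real.one_le_exp (by simpa using h0))
  have hδ' : Tendsto (deriv δ) atTop (nhds 0) :=
    HardyField.MemFun.tendsto_deriv_zero H.memFun_id hδ hδ0
  have hneg : ∀ᶠ t in atTop, deriv δ t < 0 := hδ.deriv_neg_of_tendsto_zero hpos hδ0
  have hq : H.MemFun fun t => δ t * (deriv δ t)⁻¹ := hδ.mul hδ.deriv.inv
  have hq0 : Tendsto (fun t => δ t * (deriv δ t)⁻¹) atTop (nhds 0) := by
    rw [Metric.tendsto_nhds]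
    intro ε hε
    filter_upwards [hpos, hneg, deriv_lt_neg_mul hδ hpos (inv_pos.2 hε) (hlim _ (inv_pos.2 hε))]
      with t h1 h2 h3
    rw [dist_zero_right, Real.norm_eq_abs, abs_mul, abs_inv, abs_of_pos h1, abs_of_neg h2,
      ← div_eq_mul_inv, div_lt_iff₀ (neg_pos.2 h2)]
    have h4 : ε * (ε⁻¹ * δ t) < ε * -deriv δ t := mul_lt_mul_of_pos_left (by linarith) hε
    rwa [mul_inv_cancel_left₀ hε.ne'] at h4
  have hq' := HardyField.MemFun.tendsto_deriv_zero H.memFun_id hq hq0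
  have hV : H.MemFun fun t => -(deriv δ t)⁻¹ := hδ.deriv.inv.neg
  refine ⟨fun t => -(deriv δ t)⁻¹, hV, ?_, ?_⟩
  · have h1 : Tendsto (fun t => -deriv δ t) atTop (nhdsWithin 0 (Ioi 0)) := by
      refine tendsto_nhdsWithin_iff.2 ⟨by simpa using hδ'.neg, ?_⟩
      filter_upwards [hneg] with t ht using neg_pos.2 ht
    refine (tendsto_inv_nhdsGT_zero.comp h1).congr fun t => ?_
    simp
  · have hVδ : Tendsto (fun t => deriv (fun t => -(deriv δ t)⁻¹) t * δ t) atTop (nhds 1) := by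
      have h1 : Tendsto (fun t => 1 - deriv (fun t => δ t * (deriv δ t)⁻¹) t) atTop (nhds 1) := by
        simpa using hq'.const_sub 1
      refine h1.congr' ?_
      filter_upwards [hneg, hδ.eventually_differentiableAt,
        hδ.deriv.eventually_differentiableAt] with t h1 h2 h3
      have hi := h3.hasDerivAt.fun_inv h1.ne
      rw [(h2.hasDerivAt.fun_mul hi).deriv, hi.fun_neg.deriv]
      have := h1.ne
      field_simp
      ring
    rw [Metric.tendsto_nhds]
    intro ε hε
    obtain ⟨η, hη0, hη1, hη2⟩ : ∃ η : ℝ, 0 < η ∧ η ≤ 1 / 2 ∧ 4 * η ≤ ε :=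
      ⟨min (1 / 2) (ε / 4), by positivity, min_le_left _ _, by
        linarith [min_le_right (1 / 2) (ε / 4)]⟩
    filter_upwards [hV.eventually_exists_deriv, hδ.eventually_exists_deriv,
      eventually_forall_ge_atTop.2 (Metric.tendsto_nhds.1 hVδ η hη0),
      eventually_forall_ge_atTop.2 (Metric.tendsto_nhds.1 hδ' η hη0),
      eventually_forall_ge_atTop.2 hneg, eventually_forall_ge_atTop.2 hpos]
      with t hmV hmδ h1 h2 h3 h4
    obtain ⟨c, hc1, hc2, hc⟩ := hmV t (t + δ t) le_rfl (by linarith [h4 t le_rfl])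
    obtain ⟨b, hb1, hb2, hb⟩ := hmδ t c le_rfl hc1
    rw [hc, Real.dist_eq, add_sub_cancel_left]
    have e1 := h1 c hc1.le
    rw [Real.dist_eq, abs_lt] at e1
    have e2 := h2 b hb1.le
    rw [Real.dist_eq, abs_lt, sub_zero] at e2
    have e3 := h3 b hb1.le
    have p1 := h4 t le_rfl
    have p2 := h4 c hc1.le
    set D := deriv (fun t => -(deriv δ t)⁻¹) c
    have hD : 0 < D := by
      by_contra! hcon
      nlinarith
    have k1 : δ c ≤ δ t := by nlinarith
    have k2 : (1 - η) * δ t ≤ δ c := by nlinarith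
    have k3 : D * δ c ≤ D * δ t := mul_le_mul_of_nonneg_left k1 hD.le
    have k4 : D * ((1 - η) * δ t) ≤ D * δ c := mul_le_mul_of_nonneg_left k2 hD.le
    rw [abs_lt]
    constructor
    · linarith
    · by_contra! hcon
      nlinarith

end Abel

/-! ### The second growth axiom near a translation -/

section Commutator

variable {H : ExpHardyField}

/-- With `f = id + φ` and `g = id + 1 + E`, the inequality `g ∘ f < f ∘ g` says that the increment of
`E` from `t` to `f t` is less than that of `φ` from `t` to `g t`. -/
theorem sub_lt_sub_of_tendsto {φ E a b : ℝ → ℝ} (hφ : H.MemFun φ) (hE : H.MemFun E)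
    (hφ' : Tendsto φ atTop atTop) (hE0 : Tendsto E atTop (nhds 0))
    (ha : ∀ t, a t = t + φ t) (hb : ∀ t, b t = t + 1 + E t) :
    ∀ᶠ t in atTop, E (a t) - E t < φ (b t) - φ t := by
  have hE1 : ∀ᶠ t in atTop, |E t| < 1 / 2 := by
    filter_upwards [Metric.tendsto_nhds.1 hE0 (1 / 2) (by norm_num)] with t ht
    simpa using ht
  have hφpos := hφ.deriv_pos_of_tendsto_atTop hφ'
  -- the claim is immediate when `E` decreases or `φ'` is bounded away from `0`; otherwise `φ'` and
  -- `E'` decrease to `0`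
  rcases (HardyField.MemFun.const 0).eventually_lt_or_le hE.deriv with hEd | hEd
  swap
  · filter_upwards [hE1, hE.eventually_antitoneOn hEd, hφ.eventually_strictMonoOn hφpos,
      hφ'.eventually_gt_atTop 0] with t h1 h2 h3 h4
    rw [abs_lt] at h1
    have hta : t ≤ a t := by linarith [ha t]
    have htb : t < b t := by linarith [hb t]
    linarith [h2 self_mem_Ici hta hta, h3 self_mem_Ici htb.le htb]
  by_cases hc : ∃ c : ℝ, 0 < c ∧ ∀ᶠ t in atTop, c ≤ deriv φ t
  · obtain ⟨c, hc0, hc⟩ := hc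
    have hE2 := Metric.tendsto_nhds.1 hE0 (c / 4) (by linarith)
    filter_upwards [hE1, eventually_forall_ge_atTop.2 hE2, eventually_forall_ge_atTop.2 hc,
      hφ.eventually_exists_deriv, hφ'.eventually_gt_atTop 0] with t h1 h2 h3 h4 h5
    rw [abs_lt] at h1
    have hta : t ≤ a t := by linarith [ha t]
    have htb : t + 1 / 2 < b t := by linarith [hb t]
    obtain ⟨x, hx1, hx2, hx⟩ := h4 t (b t) le_rfl (by linarith)
    have e1 := h2 t le_rfl
    have e2 := h2 (a t) hta
    rw [dist_zero_right, Real.norm_eq_abs, abs_lt] at e1 e2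
    have e3 := h3 x hx1.le
    have : c * (1 / 2) ≤ deriv φ x * (b t - t) :=
      mul_le_mul e3 (by linarith) (by norm_num) (by linarith)
    linarith
  · have hφ0 : Tendsto (deriv φ) atTop (nhds 0) := by
      rw [Metric.tendsto_nhds]
      intro c hc0
      have hlt : ∀ᶠ t in atTop, deriv φ t < c :=
        (hφ.deriv.eventually_lt_or_le (HardyField.MemFun.const c)).resolve_right
          fun h => hc ⟨c, hc0, h⟩
      filter_upwards [hlt, hφpos] with t h1 h2
      rwa [dist_zero_right, Real.norm_eq_abs, abs_of_pos h2]
    have hφanti := hφ.deriv.eventually_strictAntiOn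
      (hφ.deriv.deriv_neg_of_tendsto_zero hφpos hφ0)
    have hE'0 := HardyField.MemFun.tendsto_deriv_zero H.memFun_id hE hE0
    have hEanti := hE.deriv.eventually_strictAntiOn
      (hE.deriv.deriv_neg_of_tendsto_zero hEd hE'0)
    -- `φ'' ≺ φ'`, as `φ' → 0` and `φ → ∞`
    have hφ2 := hφ.deriv.abs_deriv_lt hφ hφ0 hφ' (c := 1 / 8) (by norm_num)
    -- `E' ≺ φ' / φ`, as `log ∘ φ → ∞`; here `log ∘ φ` is obtained as `exp⁻¹ ∘ φ`
    have hlog : H.MemFun fun t => Real.log (φ t) := by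
      obtain ⟨w, hw⟩ := exists_isRep
        ((H.ofFun Real.exp H.memFun_exp Real.tendsto_exp_atTop)⁻¹ * H.ofFun φ hφ hφ')
      have h := ((isRep_ofFun H.memFun_exp Real.tendsto_exp_atTop).mul hw).eq_iff
        (isRep_ofFun hφ hφ')
      rw [mul_inv_cancel_left] at h
      refine hw.memFun.congr ?_
      filter_upwards [h.1 rfl] with t ht
      rw [← ht, Real.log_exp]
    have hEφ := hE.abs_deriv_lt hlog hE0 (Real.tendsto_log_atTop.comp hφ') (c := 1 / 8)
      (by norm_num)
    filter_upwards [hE1, hE.eventually_exists_deriv, hφ.eventually_exists_deriv,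
      hφ.deriv.eventually_exists_deriv, hφanti, hEanti, hEφ, hφ'.eventually_gt_atTop 0,
      eventually_forall_ge_atTop.2 hφ2, eventually_forall_ge_atTop.2 hφpos,
      hφ.eventually_differentiableAt] with t h1 hmE hmφ hmφ2 h5 h6 h7 h8 h9 h10 h11
    rw [abs_lt] at h1
    have hta : t < a t := by linarith [ha t]
    have htb : t + 1 / 2 < b t := by linarith [hb t]
    have htb2 : b t < t + 2 := by linarith [hb t]
    obtain ⟨x, hx1, hx2, hx⟩ := hmE t (a t) le_rfl hta
    obtain ⟨y, hy1, hy2, hy⟩ := hmφ t (b t) le_rfl (by linarith)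
    obtain ⟨z, hz1, hz2, hz⟩ := hmφ2 t y le_rfl hy1
    have e1 : deriv E x ≤ deriv E t := (h6 self_mem_Ici hx1.le hx1).le
    have e2 : deriv φ z < deriv φ t := h5 self_mem_Ici hz1.le hz1
    have e3 := (abs_lt.1 (h9 z hz1.le)).1
    have p0 := h10 t le_rfl
    have e4 : deriv φ t / 2 ≤ deriv φ y := by nlinarith
    have e5 : deriv φ t / 2 * (1 / 2) ≤ deriv φ y * (b t - t) :=
      mul_le_mul e4 (by linarith) (by norm_num) (by linarith)
    have e6 : deriv E t * φ t ≤ 1 / 8 * deriv φ t := by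
      have := (le_abs_self _).trans h7.le
      rw [deriv.log h11 h8.ne', ← mul_div_assoc, le_div_iff₀ h8] at this
      exact this
    have e7 : deriv E x * (a t - t) ≤ deriv E t * φ t := by
      rw [ha t, add_sub_cancel_left]
      exact mul_le_mul_of_nonneg_right e1 h8.le
    rw [hx, hy]
    linarith

theorem mul_lt_mul_swap_of_isNear_one {f g : H.Large} (hg : IsNear H.translation g 1)
    (hf : ∀ r, H.translation r < f) : g * f < f * g := by
  obtain ⟨a, ha⟩ := exists_isRep f
  obtain ⟨b, hb⟩ := exists_isRep g
  rw [(hb.mul ha).lt_iff (ha.mul hb)]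
  have hφ : Tendsto (fun t => a t - t) atTop atTop := by
    refine tendsto_atTop.2 fun r => ?_
    filter_upwards [((isRep_translation r).lt_iff ha).1 (hf r)] with t ht
    linarith
  have hE : Tendsto (fun t => b t - t - 1) atTop (nhds 0) := by
    simpa using (hg.tendsto_sub hb).sub_const 1
  filter_upwards [sub_lt_sub_of_tendsto (a := a) (b := b) (ha.memFun.sub H.memFun_id)
    ((hb.memFun.sub H.memFun_id).sub (HardyField.MemFun.const 1)) hφ hE (fun t => by ring)
    (fun t => by ring)] with t ht
  linarith

end Commutator

/-! ### Logarithms in an exponential H-field -/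

section ExponentialFields

variable {K : Type*} [Field K] [LinearOrder K] [IsStrictOrderedRing K]

theorem HField.mem_of_abs_le (E : HField K) {a b : K} (hb : b ∈ E.valRing) (hab : |a| ≤ b) :
    a ∈ E.valRing :=
  E.convex.out (neg_mem hb) hb (abs_le.1 hab)

/-- As `𝒪` is convex, no element of `𝓸` is `≤ -1`. -/
theorem HField.one_add_pos (E : HField K) {a : K} (ha : a ∈ E.valRing.nonunits) : 0 < 1 + a := by
  by_contra! h
  have h1 : 1 ≤ -a := by linarith
  have h2 : a⁻¹ ∈ E.valRing := by
    refine E.mem_of_abs_le E.valRing.one_mem ?_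
    rw [abs_inv]
    exact inv_le_one_of_one_le₀ (h1.trans (neg_le_abs a))
  have h3 := E.valRing.mem_nonunits_iff.1 ha
  have h4 := (E.valRing.valuation_le_one_iff _).2 h2
  have ha0 : a ≠ 0 := by
    rintro rfl
    norm_num at h1
  have h5 := mul_lt_mul'' h3 (lt_of_le_of_ne h4 ?_) zero_le zero_le
  · rw [← map_mul, mul_inv_cancel₀ ha0] at h5
    simp at h5
  · intro h6
    rw [map_inv₀, inv_eq_one] at h6
    exact h3.ne h6

variable [Algebra ℝ K]

theorem algebraMap_mono : Monotone (algebraMap ℝ K) := by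
  intro r s hrs
  rw [← sub_nonneg, ← map_sub, ← Real.mul_self_sqrt (sub_nonneg.2 hrs), map_mul]
  exact mul_self_nonneg _

theorem HField.algebraMap_mem (E : HField K) (r : ℝ) : algebraMap ℝ K r ∈ E.valRing := by
  obtain ⟨n, hn⟩ := exists_nat_ge |r|
  refine E.mem_of_abs_le (natCast_mem E.valRing n) ?_
  rw [← map_natCast (algebraMap ℝ K)]
  refine abs_le.2 ⟨?_, algebraMap_mono ((le_abs_self r).trans hn)⟩
  rw [← map_neg]
  exact algebraMap_mono (neg_le.1 ((neg_le_abs r).trans hn))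

variable (E : ExponentialHField K)

theorem ExponentialHField.logFun_mul {a b : K} (ha : 0 < a) (hb : 0 < b) :
    E.logFun (a * b) = E.logFun a + E.logFun b := by
  rw [logFun, logFun, logFun, dif_pos ha, dif_pos hb, dif_pos (mul_pos ha hb), ← E.log_mul]
  rfl

theorem ExponentialHField.logFun_one_add_mem {a : K} (ha : a ∈ E.valRing.nonunits) :
    E.logFun (1 + a) ∈ E.valRing.nonunits := by
  have hpos := E.one_add_pos ha
  rw [logFun, dif_pos hpos]
  have : E.log ⟨1 + a, hpos⟩ ∈ (E.valRing.nonunits : Set K) := by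
    rw [← E.log_image]
    exact ⟨_, by simpa using ha, rfl⟩
  exact this

theorem ExponentialHField.der_logFun {a : K} (ha : 0 < a) : E.der (E.logFun a) = E.der a / a := by
  rw [logFun, dif_pos ha, ← E.der_log]

/-- If `a` is infinite and `b - a` lies in `𝒪`, then `b / a` lies in `1 + 𝓸`, so that the logarithms of
`a` and `b` even differ by an element of `𝓸`. -/
theorem ExponentialHField.logFun_sub_mem {a b : K} (ha : 0 < a) (ha' : a ∉ E.valRing)
    (hba : b - a ∈ E.valRing) : E.logFun b - E.logFun a ∈ E.valRing := by
  have h1 : (b - a) * a⁻¹ ∈ E.valRing.nonunits := by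
    rw [E.valRing.mem_nonunits_iff, map_mul, map_inv₀]
    have h2 := (E.valRing.valuation_le_one_iff _).2 hba
    have h3 : 1 < E.valRing.valuation a := by
      rw [← not_le, E.valRing.valuation_le_one_iff]
      exact ha'
    calc _ ≤ 1 * (E.valRing.valuation a)⁻¹ := by gcongr
      _ < 1 := by rw [one_mul]; exact inv_lt_one_of_one_lt₀ h3
  have h2 : b = a * (1 + (b - a) * a⁻¹) := by
    field_simp
    ring
  rw [h2, E.logFun_mul ha (E.one_add_pos h1), add_sub_cancel_left]
  exact E.valRing.nonunits_le (E.logFun_one_add_mem h1)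

end ExponentialFields

/-! ### Levels of germs -/

section GermLevel

variable {H : ExpHardyField}

/-- The germ of `exp` as an element of the group. -/
noncomputable def ExpHardyField.expLarge (H : ExpHardyField) : H.Large :=
  H.ofFun Real.exp H.memFun_exp Real.tendsto_exp_atTop

theorem isRep_exp : IsRep H.expLarge Real.exp := rfl

theorem IsRep.exp_inv_mul {f : H.Large} {u : ℝ → ℝ} (hf : IsRep f u) :
    IsRep (H.expLarge⁻¹ * f) fun t => Real.log (u t) := by
  obtain ⟨w, hw⟩ := exists_isRep (H.expLarge⁻¹ * f)
  have h := ((isRep_exp.mul hw).eq_iff hf).1 (mul_inv_cancel_left _ _)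
  rw [IsRep, hw, Germ.coe_eq]
  filter_upwards [h] with t ht
  rw [← ht, Real.log_exp]

/-- Germs at bounded distance from the identity. -/
def IsBounded (u : H.Large) : Prop := ∃ r, H.translation (-r) ≤ u ∧ u ≤ H.translation r

/-- An element of the group as an element of the Hardy field. -/
def ExpHardyField.Large.toSubring (f : H.Large) : H.toSubring := ⟨f.1, f.2.1⟩

variable {K : Type*} [Field K] [LinearOrder K] [IsStrictOrderedRing K] [Algebra ℝ K]
  {E : ExponentialHField K} {Φ : H.toSubring →+* K}

section Embedding

variable (hΦ : IsHardyEmbedding H.toHardyField E Φ)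
include hΦ

theorem IsHardyEmbedding.pos (f : H.Large) : 0 < Φ f.toSubring := by
  rw [← map_zero Φ, hΦ.lt_iff]
  exact f.2.2 0

theorem IsHardyEmbedding.notMem (f : H.Large) : Φ f.toSubring ∉ E.valRing := by
  rw [hΦ.mem_valRing_iff]
  rintro ⟨r, hr⟩
  obtain ⟨u, hu⟩ := exists_isRep f
  have h1 : Germ.LiftPred (fun y : ℝ => |y| < r) (u : RGerm) := hu ▸ hr
  obtain ⟨t, h2, h3⟩ := ((Germ.liftPred_coe.1 h1).and (hu.tendsto.eventually_gt_atTop r)).exists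
  exact absurd (le_abs_self (u t)) (h2.trans h3).not_ge

theorem IsHardyEmbedding.algebraMap_lt (f : H.Large) (r : ℝ) :
    algebraMap ℝ K r < Φ f.toSubring := by
  by_contra! h
  refine hΦ.notMem f (E.mem_of_abs_le (E.algebraMap_mem r) ?_)
  rwa [abs_of_pos (hΦ.pos f)]

/-- `Φ` commutes with the logarithm up to a real constant, because `log ∘ Φ` and `Φ ∘ log` have the
same derivative. -/
theorem IsHardyEmbedding.logFun_sub_mem (f : H.Large) :
    E.logFun (Φ f.toSubring) - Φ (H.expLarge⁻¹ * f).toSubring ∈ E.valRing := by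
  have h0 : E.der (E.logFun (Φ f.toSubring) - Φ (H.expLarge⁻¹ * f).toSubring) = 0 := by
    have hpos := hΦ.pos f
    rw [map_sub, E.der_logFun hpos, sub_eq_zero, div_eq_iff hpos.ne', ← hΦ.map_deriv,
      ← hΦ.map_deriv, ← map_mul]
    congr 1
    refine Subtype.ext ?_
    obtain ⟨u, hu⟩ := exists_isRep f
    change derivGerm f.1 = derivGerm (H.expLarge⁻¹ * f).1 * f.1
    rw [hu.exp_inv_mul, hu]
    refine Germ.coe_eq.2 ?_
    filter_upwards [hu.memFun.eventually_differentiableAt, hu.tendsto.eventually_gt_atTop 0]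
      with t h1 h2
    rw [deriv.log h1 h2.ne', div_mul_cancel₀ _ h2.ne']
  obtain ⟨r, hr⟩ := (E.der_eq_zero_iff _).1 h0
  rw [← hr]
  exact E.algebraMap_mem r

theorem IsHardyEmbedding.logIter_sub_mem (f : H.Large) (k : ℕ) :
    E.logIter k (Φ f.toSubring) - Φ ((H.expLarge ^ k)⁻¹ * f).toSubring ∈ E.valRing := by
  induction k with
  | zero =>
    rw [pow_zero, inv_one, one_mul]
    simp [ExponentialHField.logIter]
  | succ k ih =>
    have h1 := E.logFun_sub_mem (hΦ.pos _) (hΦ.notMem _) ih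
    have h2 := hΦ.logFun_sub_mem ((H.expLarge ^ k)⁻¹ * f)
    rw [← mul_assoc, ← mul_inv_rev, ← pow_succ] at h2
    have h3 := add_mem h1 h2
    rw [sub_add_sub_cancel] at h3
    rwa [ExponentialHField.logIter, Function.iterate_succ_apply']

theorem IsHardyEmbedding.isBounded_mul_inv {f g : H.Large}
    (h : Φ f.toSubring - Φ g.toSubring ∈ E.valRing) : IsBounded (f * g⁻¹) := by
  rw [← map_sub, hΦ.mem_valRing_iff] at h
  obtain ⟨r, hr⟩ := h
  obtain ⟨u, hu⟩ := exists_isRep f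
  obtain ⟨v, hv⟩ := exists_isRep g
  have h1 : Germ.LiftPred (fun y : ℝ => |y| < r) ((u : RGerm) - (v : RGerm)) := hu ▸ hv ▸ hr
  have h2 : ∀ᶠ t in atTop, |u t - v t| < r := h1
  refine ⟨r, le_of_lt ?_, le_of_lt ?_⟩
  · rw [lt_mul_inv_iff_mul_lt, ((isRep_translation _).mul hv).lt_iff hu]
    filter_upwards [h2] with t ht
    linarith [(abs_lt.1 ht).1]
  · rw [mul_inv_lt_iff_lt_mul, hu.lt_iff ((isRep_translation _).mul hv)]
    filter_upwards [h2] with t ht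
    linarith [(abs_lt.1 ht).2]

/-- The level condition, transferred from `K` to the group: iterated logarithms in `K` and in the
group differ by elements of the valuation ring, and `log^{[k]} ∘ f - log^{[k - l]}` bounded means
that `f ∘ exp^{[-l]}` has a conjugate at bounded distance from the identity. -/
theorem exists_level (hlevel : LevelCondition E (Φ ⟨idGerm, H.id_mem⟩)) (f : H.Large) :
    ∃ l : ℤ, ∃ k : ℕ,
      IsBounded ((H.expLarge ^ k)⁻¹ * (f * (H.expLarge ^ l)⁻¹) * H.expLarge ^ k) := by
  obtain ⟨l, hl⟩ := hlevel _ (hΦ.algebraMap_lt f)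
  obtain ⟨k, hk, hkl⟩ := (hl.and (eventually_ge_atTop l.toNat)).exists
  obtain ⟨m, hm⟩ : ∃ m : ℕ, (k : ℤ) - l = m := ⟨((k : ℤ) - l).toNat, by lia⟩
  rw [hm, Int.toNat_natCast] at hk
  have h1 := hΦ.logIter_sub_mem f k
  have h2 := hΦ.logIter_sub_mem 1 m
  have h3 : Φ ((H.expLarge ^ k)⁻¹ * f).toSubring - Φ ((H.expLarge ^ m)⁻¹ * 1).toSubring ∈
      E.valRing := by
    have hk' : E.logIter k (Φ f.toSubring) - E.logIter m (Φ (1 : H.Large).toSubring) ∈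
      E.valRing := E.valRing.nonunits_le hk
    convert add_mem (sub_mem hk' h1) h2 using 1
    ring
  refine ⟨l, k, ?_⟩
  convert hΦ.isBounded_mul_inv h3 using 1
  rw [mul_one, inv_inv, ← zpow_natCast _ m, ← hm, ← zpow_natCast]
  group

end Embedding

theorem translation_lt_exp (r : ℝ) : H.translation r < H.expLarge := by
  rw [(isRep_translation r).lt_iff isRep_exp]
  have h : Tendsto (fun t => Real.exp t - t) atTop atTop := by
    have := Real.tendsto_exp_div_pow_atTop 1
    refine tendsto_atTop_mono' atTop ?_ tendsto_id
    filter_upwards [this.eventually_ge_atTop 2, eventually_gt_atTop 0] with t h1 h2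
    rw [pow_one, le_div_iff₀ h2] at h1
    simp only [id]
    linarith
  filter_upwards [h.eventually_gt_atTop r] with t ht
  linarith

theorem translation_mul_exp_le {r : ℝ} (hr : 0 ≤ r) :
    H.translation r * H.expLarge ≤ H.expLarge * H.translation r := by
  refine le_of_not_gt fun h => ?_
  rw [(isRep_exp.mul (isRep_translation r)).lt_iff ((isRep_translation r).mul isRep_exp)] at h
  obtain ⟨t, ht, h0⟩ := (h.and (eventually_ge_atTop 0)).exists
  rw [Real.exp_add] at ht
  nlinarith [Real.add_one_le_exp r, Real.one_le_exp h0]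

theorem IsBounded.mul {u v : H.Large} (hu : IsBounded u) (hv : IsBounded v) :
    IsBounded (u * v) := by
  obtain ⟨r, h1, h2⟩ := hu
  obtain ⟨s, h3, h4⟩ := hv
  refine ⟨r + s, ?_, ?_⟩
  · rw [neg_add, translation_add]
    exact mul_le_mul' h1 h3
  · rw [translation_add]
    exact mul_le_mul' h2 h4

theorem IsBounded.inv {u : H.Large} (hu : IsBounded u) : IsBounded u⁻¹ := by
  obtain ⟨r, h1, h2⟩ := hu
  rw [translation_neg translation_add] at h1
  refine ⟨r, ?_, inv_le'.1 h1⟩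
  rw [translation_neg translation_add]
  exact inv_le_inv_iff.2 h2

theorem isBounded_one : IsBounded (1 : H.Large) :=
  ⟨0, by rw [neg_zero, translation_zero translation_add], by
    rw [translation_zero translation_add]⟩

theorem IsBounded.conj_exp {u : H.Large} (hu : IsBounded u) :
    IsBounded (H.expLarge⁻¹ * u * H.expLarge) := by
  obtain ⟨r, h1, h2⟩ := hu
  have hr : 0 ≤ r := by
    have := translation_strictMono.le_iff_le.1 (h1.trans h2)
    linarith
  have h := translation_mul_exp_le (H := H) hr
  refine ⟨r, ?_, ?_⟩
  · rw [translation_neg translation_add, inv_le', mul_inv_rev, mul_inv_rev, inv_inv, ← mul_assoc,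
      mul_assoc, inv_mul_le_iff_le_mul]
    rw [translation_neg translation_add, inv_le'] at h1
    exact (mul_le_mul_left h1 _).trans h
  · rw [mul_assoc, inv_mul_le_iff_le_mul]
    exact (mul_le_mul_left h2 _).trans h

theorem IsBounded.conj_exp_pow {u : H.Large} {k m : ℕ} (hkm : k ≤ m)
    (hu : IsBounded ((H.expLarge ^ k)⁻¹ * u * H.expLarge ^ k)) :
    IsBounded ((H.expLarge ^ m)⁻¹ * u * H.expLarge ^ m) := by
  induction m, hkm using Nat.le_induction with
  | base => exact hu
  | succ m _ ih =>
    convert ih.conj_exp using 1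
    rw [pow_succ]
    group

/-- The germs of level zero: those whose conjugate by some iterate of `exp` is at bounded distance
from the identity. -/
def ExpHardyField.levelZero (H : ExpHardyField) : Subgroup H.Large where
  carrier := {u | ∃ k : ℕ, IsBounded ((H.expLarge ^ k)⁻¹ * u * H.expLarge ^ k)}
  one_mem' := ⟨0, by simpa using isBounded_one⟩
  mul_mem' := by
    rintro u v ⟨k, hk⟩ ⟨m, hm⟩
    refine ⟨max k m, ?_⟩
    convert (hk.conj_exp_pow (le_max_left k m)).mul (hm.conj_exp_pow (le_max_right k m)) using 1
    group
  inv_mem' := by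
    rintro u ⟨k, hk⟩
    refine ⟨k, ?_⟩
    convert hk.inv using 1
    group

theorem lt_exp_of_mem_levelZero {u : H.Large} (hu : u ∈ H.levelZero) : u < H.expLarge := by
  obtain ⟨k, r, -, hr⟩ := hu
  have h := hr.trans_lt (translation_lt_exp r)
  rw [mul_assoc, inv_mul_lt_iff_lt_mul, ← pow_succ, pow_succ'] at h
  exact lt_of_mul_lt_mul_right' h

theorem exp_mem_normalizer : H.expLarge ∈ Subgroup.normalizer (H.levelZero : Set H.Large) := by
  rw [Subgroup.mem_normalizer_iff]
  have h : ∀ (u : H.Large) (k : ℕ), (H.expLarge ^ (k + 1))⁻¹ * (H.expLarge * u * H.expLarge⁻¹) *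
      H.expLarge ^ (k + 1) = (H.expLarge ^ k)⁻¹ * u * H.expLarge ^ k := by
    intro u k
    rw [pow_succ']
    group
  intro u
  constructor
  · rintro ⟨k, hk⟩
    exact ⟨k + 1, by rwa [h]⟩
  · rintro ⟨k, hk⟩
    have := IsBounded.conj_exp_pow k.le_succ hk
    exact ⟨k, by rwa [h] at this⟩

/-- Both `exp` and `levelZero` lie in the normaliser, and together they generate the group. -/
theorem levelZero_normal (h : ∀ f : H.Large, ∃ l : ℤ, f * (H.expLarge ^ l)⁻¹ ∈ H.levelZero) :
    H.levelZero.Normal := by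
  rw [← Subgroup.normalizer_eq_top_iff, eq_top_iff]
  rintro f -
  obtain ⟨l, hl⟩ := h f
  have := mul_mem (Subgroup.le_normalizer hl) (zpow_mem (exp_mem_normalizer (H := H)) l)
  rwa [inv_mul_cancel_right] at this

/-- Conjugating by `exp ∘ exp` brings a germ at bounded distance from the identity so close to it
that Abel's equation can be solved approximately. -/
theorem exists_isNear_conj_of_isBounded {x : H.Large} (hx : IsBounded x) (hx1 : 1 < x) :
    ∃ h, IsNear H.translation (h * x * h⁻¹) 1 := by
  obtain ⟨r, -, hr⟩ := hx
  set y := (H.expLarge ^ 2)⁻¹ * x * H.expLarge ^ 2 with hy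
  have hy1 : 1 < y := by
    rw [hy, mul_assoc, lt_inv_mul_iff_mul_lt, mul_one]
    simpa using hx1
  have hyr : H.expLarge ^ 2 * y ≤ H.translation r * H.expLarge ^ 2 := by
    rw [hy, mul_assoc, mul_inv_cancel_left]
    exact mul_le_mul_left hr _
  obtain ⟨v, hv⟩ := exists_isRep y
  have hpos : ∀ᶠ t in atTop, 0 < v t - t := by
    filter_upwards [(isRep_one.lt_iff hv).1 hy1] with t ht
    linarith
  have hle : ∀ᶠ t in atTop, Real.exp (Real.exp (v t)) < Real.exp (Real.exp t) + (r + 1) := by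
    have h1 : H.expLarge ^ 2 * y < H.translation (r + 1) * H.expLarge ^ 2 :=
      hyr.trans_lt (mul_lt_mul_left (translation_strictMono (lt_add_one r)) _)
    exact (((isRep_exp.pow 2).mul hv).lt_iff ((isRep_translation _).mul (isRep_exp.pow 2))).1 h1
  have hδ : H.MemFun fun t => v t - t := hv.memFun.sub H.memFun_id
  have hlim : ∀ c > 0, Tendsto (fun t => (v t - t) * Real.exp (c * t)) atTop (nhds 0) := by
    intro c _
    obtain ⟨n, hn⟩ := exists_nat_ge c
    have h1 : Tendsto (fun t => (r + 1) * (Real.exp t ^ n * Real.exp (-Real.exp t))) atTop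
        (nhds 0) := by
      simpa using ((Real.tendsto_pow_mul_exp_neg_atTop_nhds_zero n).comp
        Real.tendsto_exp_atTop).const_mul (r + 1)
    refine squeeze_zero' (hpos.mono fun t h => mul_nonneg h.le (Real.exp_pos _).le) ?_ h1
    filter_upwards [hpos, hle, eventually_ge_atTop 0] with t h2 h3 h4
    -- convexity of `exp`, applied twice, turns the additive bound on `exp (exp (v t))` into
    -- `v t - t ≤ (r + 1) exp (- exp t)`
    have h5 : Real.exp t + (v t - t) ≤ Real.exp (v t) := by
      have e1 := Real.add_one_le_exp (v t - t)
      have e2 : Real.exp (v t) = Real.exp t * Real.exp (v t - t) := by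
        rw [← Real.exp_add]
        congr 1
        ring
      rw [e2]
      nlinarith [Real.one_le_exp h4]
    have h6 : Real.exp (Real.exp t) * (1 + (v t - t)) ≤ Real.exp (Real.exp (v t)) := by
      refine le_trans ?_ (Real.exp_le_exp.2 h5)
      rw [Real.exp_add]
      exact mul_le_mul_of_nonneg_left (by linarith [Real.add_one_le_exp (v t - t)])
        (Real.exp_pos _).le
    have h7 : v t - t ≤ (r + 1) * Real.exp (-Real.exp t) := by
      rw [Real.exp_neg, ← div_eq_mul_inv, le_div_iff₀ (Real.exp_pos _)]
      linarith
    have h8 : Real.exp (c * t) ≤ Real.exp t ^ n := by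
      rw [← Real.exp_nat_mul]
      exact Real.exp_le_exp.2 (mul_le_mul_of_nonneg_right hn h4)
    calc (v t - t) * Real.exp (c * t)
        ≤ ((r + 1) * Real.exp (-Real.exp t)) * Real.exp t ^ n :=
          mul_le_mul h7 h8 (Real.exp_pos _).le (h2.le.trans h7)
      _ = _ := by ring
  obtain ⟨V, hV, hVtop, hVlim⟩ := exists_approx_abel hδ hpos hlim
  have hnear := isNear_conj_of_tendsto (r := 1) hv (isRep_ofFun hV hVtop) (by simpa using hVlim)
  refine ⟨H.ofFun V hV hVtop * (H.expLarge ^ 2)⁻¹, ?_⟩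
  convert hnear using 1
  rw [hy]
  group

theorem exists_isNear_conj {u : H.Large} (hu : u ∈ H.levelZero) (hu1 : 1 < u) :
    ∃ h, IsNear H.translation (h * u * h⁻¹) 1 := by
  obtain ⟨k, hk⟩ := hu
  obtain ⟨h, hh⟩ := exists_isNear_conj_of_isBounded hk (by
    rw [mul_assoc, lt_inv_mul_iff_mul_lt, mul_one]
    simpa using hu1)
  refine ⟨h * (H.expLarge ^ k)⁻¹, ?_⟩
  convert hh using 1
  group

end GermLevel

end GrowthOrder

theorem mainTheorem6 (H : GrowthOrder.ExpHardyField)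
    {K : Type*} [Field K] [LinearOrder K] [IsStrictOrderedRing K] [Algebra ℝ K]
    (E : GrowthOrder.ExponentialHField K) (Φ : H.toSubring →+* K)
    (hΦ : GrowthOrder.IsHardyEmbedding H.toHardyField E Φ)
    (hlevel : GrowthOrder.LevelCondition E (Φ ⟨GrowthOrder.idGerm, H.id_mem⟩)) :
    GrowthOrder.IsGrowthOrderGroup H.Large ∧
      GrowthOrder.HasArchimedeanCentralisers H.Large := by
  have hlev : ∀ f : H.Large, ∃ l : ℤ, f * (H.expLarge ^ l)⁻¹ ∈ H.levelZero :=
    GrowthOrder.exists_level hΦ hlevel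
  have hN : H.levelZero.Normal := GrowthOrder.levelZero_normal hlev
  refine ⟨GrowthOrder.isGrowthOrderGroup_of_level GrowthOrder.powersCofinal_large
    (fun u => GrowthOrder.lt_exp_of_mem_levelZero) (fun f => ?_) GrowthOrder.translation_add
    GrowthOrder.translation_strictMono (fun f => GrowthOrder.exists_eq_translation)
    (fun u => GrowthOrder.exists_isNear_conj)
    (fun f g => GrowthOrder.mul_lt_mul_swap_of_isNear_one),
    GrowthOrder.powersCofinal_large.hasArchimedeanCentralisers⟩
  obtain ⟨l, hl⟩ := hlev f
  refine ⟨l, ?_⟩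
  rw [← QuotientGroup.eq_one_iff, QuotientGroup.mk_mul, QuotientGroup.mk_inv, mul_inv_eq_one] at hl
  rw [hl, QuotientGroup.mk_zpow]
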